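/- **Setting.** Let $A=(a_{i,j})_{i,j\in I}$ be a Kac–Moody matrix (finite $I$, integer entries, $a_{i,i}=2$, $a_{i,j}\le 0$ for $i\ne j$, $a_{i,j}=0\iff a_{j,i}=0$), and let $X,Y$ be free $\mathbb Z$-modules of finite rank in perfect duality, with a free family of simple roots $\alpha_i\in X$ and a free family of simple coroots $\alpha_i^\vee\in Y$ such that $\alpha_j(\alpha_i^\vee)=a_{i,j}$. Put $V=Y\otimes\mathbb R$, $r_i(v)=v-\alpha_i(v)\alpha_i^\vee$, and let $W^v\subset GL(V)$ be the Weyl group generated by the $r_i$, with length $\ell$. Let $\Phi=\{w\alpha_i\}$ be the set of real roots, $\Phi^+=\Phi\cap\sum_i\mathbb N\alpha_i$, $r_\beta=wr_iw^{-1}$ for $\beta=w\alpha_i$, and $C=\{v\in V:\alpha_i(v)>0\ \forall i\in I\}$. Let $\rho$ be any linear form on $V$ with $\rho(\alpha_i^\vee)=1$ for all $i\in I$. For $\lambda\in V$ with $\alpha_i(\lambda)\ge 0$ for all $i$, let $W^v_\lambda$ be its fixator in $W^v$; $W^v/W^v_\lambda$ carries the Bruhat–Chevalley order and the length $\ell_\lambda$,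 both defined through the representatives of minimal length. A *$\lambda$-path* is a continuous piecewise linear path $\pi:[0,1]\to V$ all of whose (existing) tangent vectors lie in $W^v\lambda$; $\pi'_-(t)$ and $\pi'_+(t)$ denote its left and right derivatives, and $w_\pm(t)$ is the element of minimal length with $\pi'_\pm(t)=w_\pm(t)\lambda$. The path is *in $Y$* if $\pi(0),\pi(1),\lambda\in Y$. A *Hecke path* of shape $\lambda$ is a $\lambda$-path such that for every $0<t<1$ there are vectors $\xi_0=\pi'_-(t),\xi_1,\dots,\xi_s=\pi'_+(t)$ and $\beta_1,\dots,\beta_s\in\Phi^+$ ($s\ge 0$) with $r_{\beta_i}(\xi_{i-1})=\xi_i$, $\beta_i(\xi_{i-1})<0$ and $\beta_i(\pi(t))\in\mathbb Z$ for $1\le i\le s$. An *LS path* of shape $\lambda$, where $\lambda\in Y$ and $\alpha_i(\lambda)\ge0$ for all $i$, is a path $\pi$ with $\pi(0)\in Y$ for which there are $0=a_0<a_1<\dots<a_r=1$ and $\tau_1,\dots,\tau_r\in W^v/W^v_\lambda$ with $\tau_j\neq\tau_{j+1}$ such that $\pi$ is affine with derivative $\tau_j(\lambda)$ on $[a_{j-1},a_j]$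 and, for $1\le j\le r-1$, there are cosets $\sigma_0=\tau_j,\dots,\sigma_s=\tau_{j+1}$ and $\beta_1,\dots,\beta_s\in\Phi^+$ with, for $1\le i\le s$, $\sigma_i=r_{\beta_i}\sigma_{i-1}$, $\sigma_i<\sigma_{i-1}$, $a_j\beta_i(\sigma_i(\lambda))\in\mathbb Z$ and $\ell_\lambda(\sigma_i)=\ell_\lambda(\sigma_{i-1})-1$. For $x\in V$ and $w\in W^v$ let $\ell_x(w)$ be the number of walls $\operatorname{Ker}\alpha$, for $\alpha\in\Phi^+$ with $\alpha(x)\in\mathbb Z$, that separate $C$ from $wC$. For a $\lambda$-path $\pi$ put $$\operatorname{ddim}(\pi)=\sum_{0<t\le1}\ell_{\pi(t)}(w_-(t)),\qquad \operatorname{codim}(\pi)=\sum_{0\le t<1}\ell_{\pi(t)}(w_+(t)).$$ **Proposition 4.4.** Let $\pi$ be a Hecke path of shape $\lambda$ in $Y$ and $\nu=\pi(1)-\pi(0)$. Then $\operatorname{ddim}(\pi)$ and $\operatorname{codim}(\pi)$ are finite, $$\operatorname{ddim}(\pi)\le\rho(\lambda-\nu)\le\operatorname{codim}(\pi),\qquad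 \operatorname{ddim}(\pi)+\operatorname{codim}(\pi)=2\rho(\lambda-\nu),$$ and the equality $\operatorname{ddim}(\pi)=\rho(\lambda-\nu)=\operatorname{codim}(\pi)$ holds if and only if $\pi$ is an LS path. -/

import Mathlib

open scoped TensorProduct

/-- A generalized Cartan matrix (Kac-Moody matrix) with integer coefficients. -/
structure IsKacMoodyMatrix {I : Type*} (A : Matrix I I ℤ) : Prop where
  diag : ∀ i, A i i = 2
  nonpos : ∀ i j, i ≠ j → A i j ≤ 0
  zero_iff : ∀ i j, A i j = 0 ↔ A j i = 0

/-- A root generating system `(A, X, Y, (αᵢ), (αᵢ^∨))`: a Kac-Moody matrix `A`, lattices `X`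
(characters) and `Y` (cocharacters) in duality, simple roots in `X`, simple coroots in `Y` with
`a i j = αⱼ(αᵢ^∨)`, such that the simple roots are free in `X` and the simple coroots are free
in `Y`. -/
structure RootGeneratingSystem (I X Y : Type*) [AddCommGroup X] [AddCommGroup Y] where
  A : Matrix I I ℤ
  kacMoody : IsKacMoodyMatrix A
  /-- the duality `X × Y → ℤ` -/
  pairing : X →ₗ[ℤ] Y →ₗ[ℤ] ℤ
  perfect : pairing.IsPerfPair
  root : I → X
  coroot : I → Y
  pairing_root_coroot : ∀ i j, pairing (root j) (coroot i) = A i j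
  free_root : LinearIndependent ℤ root
  free_coroot : LinearIndependent ℤ coroot

namespace RootGeneratingSystem

noncomputable section

variable {I X Y : Type*} [AddCommGroup X] [AddCommGroup Y] (S : RootGeneratingSystem I X Y)

/-- The real vector space `V = Y ⊗ ℝ`; it is also the affine apartment. -/
abbrev V (_S : RootGeneratingSystem I X Y) : Type _ := ℝ ⊗[ℤ] Y

/-- The inclusion of the lattice `Y` in `V`. -/
def ofY : Y →+ S.V :=
  ((TensorProduct.mk ℤ ℝ Y) 1).toAddMonoidHom

/-- The linear form on `V` defined by a character `χ ∈ X`: `c ⊗ y ↦ c * χ(y)`. -/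
def form (χ : X) : Module.Dual ℝ S.V :=
  (TensorProduct.AlgebraTensorModule.rid ℤ ℝ ℝ).toLinearMap ∘ₗ (S.pairing χ).baseChange ℝ

theorem form_tmul (χ : X) (c : ℝ) (y : Y) :
    S.form χ (c ⊗ₜ[ℤ] y) = (S.pairing χ y : ℝ) * c := by
  simp [form]

/-- The simple root `αᵢ`, as a linear form on `V`. -/
def simpleRoot (i : I) : Module.Dual ℝ S.V := S.form (S.root i)

/-- The simple coroot `αᵢ^∨`, as a vector of `V`. -/
def simpleCoroot (i : I) : S.V := S.ofY (S.coroot i)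

theorem simpleRoot_simpleCoroot (i j : I) :
    S.simpleRoot j (S.simpleCoroot i) = (S.A i j : ℝ) := by
  have h := S.form_tmul (S.root j) 1 (S.coroot i)
  rw [S.pairing_root_coroot, mul_one] at h
  exact h

theorem simpleRoot_simpleCoroot_self (i : I) : S.simpleRoot i (S.simpleCoroot i) = 2 := by
  rw [simpleRoot_simpleCoroot, S.kacMoody.diag]
  norm_num

/-- The simple reflection `rᵢ(v) = v - αᵢ(v) αᵢ^∨`, as an element of `GL(V)`. -/
def simpleReflectionGL (i : I) : S.V ≃ₗ[ℝ] S.V :=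
  Module.reflection (S.simpleRoot_simpleCoroot_self i)

/-- The vectorial Weyl group, the subgroup of `GL(V)` generated by the simple reflections. -/
def W : Subgroup (S.V ≃ₗ[ℝ] S.V) := Subgroup.closure (Set.range S.simpleReflectionGL)

/-- The simple reflection as an element of the Weyl group. -/
def simpleReflection (i : I) : S.W :=
  ⟨S.simpleReflectionGL i, Subgroup.subset_closure ⟨i, rfl⟩⟩

theorem simpleReflection_smul (i : I) (v : S.V) :
    S.simpleReflection i • v = v - S.simpleRoot i v • S.simpleCoroot i :=
  Module.reflection_apply v (S.simpleRoot_simpleCoroot_self i)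

/-- The length of `w` with respect to the simple reflections. -/
def length (w : S.W) : ℕ :=
  sInf {n : ℕ | ∃ l : List I, l.length = n ∧ (l.map S.simpleReflection).prod = w}

/-- The linear form `w α = α ∘ w⁻¹`. -/
def rootAct (w : S.W) (α : Module.Dual ℝ S.V) : Module.Dual ℝ S.V :=
  α ∘ₗ ((w⁻¹ : S.W) : S.V ≃ₗ[ℝ] S.V).toLinearMap

/-- The real roots: the forms `w αᵢ`. -/
def realRoots : Set (Module.Dual ℝ S.V) :=
  {β | ∃ (w : S.W) (i : I), β = S.rootAct w (S.simpleRoot i)}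

/-- The positive real roots: those in `Q⁺ = ∑ ℕ αᵢ`. -/
def posRoots : Set (Module.Dual ℝ S.V) :=
  {β | β ∈ S.realRoots ∧ β ∈ AddSubmonoid.closure (Set.range S.simpleRoot)}

/-- `r` is the reflection `r_β = w rᵢ w⁻¹` of the real root `β = w αᵢ`. -/
def IsReflection (β : Module.Dual ℝ S.V) (r : S.W) : Prop :=
  ∃ (w : S.W) (i : I), β = S.rootAct w (S.simpleRoot i) ∧ r = w * S.simpleReflection i * w⁻¹

/-- The fundamental chamber `αᵢ > 0` for all `i`. -/
def chamber : Set S.V := {u | ∀ i, 0 < S.simpleRoot i u}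

/-- The closed fundamental chamber. -/
def closedChamber : Set S.V := {u | ∀ i, 0 ≤ S.simpleRoot i u}

/-- The smallest element `w` (for the length) of the Weyl group with `ξ = w λ`, for `ξ` in the
orbit of `lam`, i.e. the minimal representative of its class modulo the fixator of `lam`. -/
def minElt (lam ξ : S.V) : S.W :=
  Classical.epsilon fun w : S.W =>
    w • lam = ξ ∧ ∀ w' : S.W, w' • lam = ξ → S.length w ≤ S.length w'

/-- The Bruhat-Chevalley order `u ≤ w` on the Weyl group: `u` is obtained from `w` by successive
left multiplications by reflections, each of which makes the length smaller. -/
def BruhatLE (u w : S.W) : Prop :=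
  Relation.ReflTransGen
    (fun x y : S.W => ∃ β ∈ S.posRoots, ∃ r, S.IsReflection β r ∧ y = r * x ∧
      S.length y < S.length x) w u

/-- The cosets `W / W_λ`, where `W_λ` is the fixator of `lam`. -/
abbrev Coset (lam : S.V) : Type _ := S.W ⧸ MulAction.stabilizer S.W lam

/-- The vector `σ(λ)` for a coset `σ ∈ W / W_λ`. -/
def cosetVec (lam : S.V) (σ : S.Coset lam) : S.V := MulAction.ofQuotientStabilizer S.W lam σ

/-- The minimal representative of a coset. -/
def cosetRep (lam : S.V) (σ : S.Coset lam) : S.W := S.minElt lam (S.cosetVec lam σ)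

/-- The length on `W / W_λ`: the length of the minimal representative. -/
def cosetLength (lam : S.V) (σ : S.Coset lam) : ℕ := S.length (S.cosetRep lam σ)

/-- The strict Bruhat-Chevalley order on `W / W_λ` (compare minimal representatives). -/
def CosetLT (lam : S.V) (σ τ : S.Coset lam) : Prop :=
  S.BruhatLE (S.cosetRep lam σ) (S.cosetRep lam τ) ∧ σ ≠ τ

/-! ### Paths. A path is given by a function `ℝ → V`, of which only the values on `[0, 1]`
are ever used. -/

/-- `ξ` is the derivative from the right at `t` of the (piecewise linear) path `π`. -/
def HasRightTangent (π : ℝ → S.V) (t : ℝ) (ξ : S.V) : Prop :=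
  ∃ ε > (0 : ℝ), ∀ s ∈ Set.Icc 0 ε, π (t + s) = π t + s • ξ

/-- `ξ` is the derivative from the left at `t` of the (piecewise linear) path `π`. -/
def HasLeftTangent (π : ℝ → S.V) (t : ℝ) (ξ : S.V) : Prop :=
  ∃ ε > (0 : ℝ), ∀ s ∈ Set.Icc 0 ε, π (t - s) = π t - s • ξ

/-- `π'₊(t)`. -/
def rightTangent (π : ℝ → S.V) (t : ℝ) : S.V := Classical.epsilon (S.HasRightTangent π t)

/-- `π'₋(t)`. -/
def leftTangent (π : ℝ → S.V) (t : ℝ) : S.V := Classical.epsilon (S.HasLeftTangent π t)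

/-- `0 = a₀ < a₁ < ⋯ < a_r = 1`. -/
def IsSubdivision (r : ℕ) (a : ℕ → ℝ) : Prop :=
  a 0 = 0 ∧ a r = 1 ∧ ∀ j < r, a j < a (j + 1)

/-- Piecewise linear continuous paths on `[0, 1]` (affine on the closed intervals of some
subdivision). -/
def IsPiecewiseLinear (π : ℝ → S.V) : Prop :=
  ∃ (r : ℕ) (a : ℕ → ℝ), IsSubdivision r a ∧
    ∀ j < r, ∃ ξ : S.V, ∀ t ∈ Set.Icc (a j) (a (j + 1)), π t = π (a j) + (t - a j) • ξ

/-- `λ`-paths: `lam` is in the closed fundamental chamber, and `π` is a piecewise linear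
continuous path whose existing tangent vectors are in the orbit of `lam`. -/
def IsLambdaPath (lam : S.V) (π : ℝ → S.V) : Prop :=
  lam ∈ S.closedChamber ∧ S.IsPiecewiseLinear π ∧
    ∀ t ∈ Set.Ioo (0 : ℝ) 1, ∀ ξ : S.V, S.HasLeftTangent π t ξ → S.HasRightTangent π t ξ →
      ξ ∈ MulAction.orbit S.W lam

/-- The `λ`-path `π` of shape `lam` is "in `Y`": `π(0)`, `π(1)` and `λ` are in `Y`. -/
def IsInY (lam : S.V) (π : ℝ → S.V) : Prop :=
  π 0 ∈ Set.range S.ofY ∧ π 1 ∈ Set.range S.ofY ∧ lam ∈ Set.range S.ofY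

/-- One step `ξ ↦ ξ' = r_β(ξ)` of a chain at the point `x`: `β` is a positive real root,
`β(ξ) < 0` and `β(x) ∈ ℤ`. -/
def HeckeStep (x ξ ξ' : S.V) : Prop :=
  ∃ β ∈ S.posRoots, ∃ r, S.IsReflection β r ∧ r • ξ = ξ' ∧ β ξ < 0 ∧ ∃ k : ℤ, β x = k

/-- Hecke paths of shape `lam`: `λ`-paths such that for `0 < t < 1` there is a chain (possibly of
length zero) at `π(t)` from `π'₋(t)` to `π'₊(t)`. -/
def IsHeckePath (lam : S.V) (π : ℝ → S.V) : Prop :=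
  S.IsLambdaPath lam π ∧
    ∀ t ∈ Set.Ioo (0 : ℝ) 1,
      Relation.ReflTransGen (S.HeckeStep (π t)) (S.leftTangent π t) (S.rightTangent π t)

/-- One step `σ ↦ σ' = r_β σ` of an `a`-chain in `W / W_λ`, with `β` a positive real root,
`σ' < σ`, `a β(σ'(λ)) ∈ ℤ` and `ℓ_λ(σ') = ℓ_λ(σ) - 1`. -/
def LSStep (lam : S.V) (a : ℝ) (σ σ' : S.Coset lam) : Prop :=
  ∃ β ∈ S.posRoots, ∃ r : S.W, S.IsReflection β r ∧ σ' = r • σ ∧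
    S.CosetLT lam σ' σ ∧
    (∃ k : ℤ, a * β (S.cosetVec lam σ') = k) ∧
    S.cosetLength lam σ' + 1 = S.cosetLength lam σ

/-- `π = π(λ, π₀, τ, a)` on `[0, 1]`: `π` starts in `π₀` and has direction `τⱼ(λ)` on
`[a_{j-1}, aⱼ]` for `1 ≤ j ≤ r`, with `τⱼ ≠ τ_{j+1}`. -/
def IsPathWithData (lam : S.V) (π : ℝ → S.V) (π₀ : S.V) (r : ℕ) (τ : ℕ → S.Coset lam)
    (a : ℕ → ℝ) : Prop :=
  IsSubdivision r a ∧
    (∀ j, 1 ≤ j → j < r → τ j ≠ τ (j + 1)) ∧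
    ∀ j < r, ∀ t ∈ Set.Icc (a j) (a (j + 1)),
      π t = π₀ + ∑ i ∈ Finset.range j, (a (i + 1) - a i) • S.cosetVec lam (τ (i + 1))
        + (t - a j) • S.cosetVec lam (τ (j + 1))

/-- Lakshmibai-Seshadri paths of shape `lam ∈ Y⁺`, not necessarily normalized: they start at a
point of `Y`. -/
def IsLSPath (lam : S.V) (π : ℝ → S.V) : Prop :=
  lam ∈ S.closedChamber ∧ lam ∈ Set.range S.ofY ∧
    ∃ π₀ ∈ Set.range S.ofY, ∃ (r : ℕ) (τ : ℕ → S.Coset lam) (a : ℕ → ℝ),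
      S.IsPathWithData lam π π₀ r τ a ∧
        ∀ j, 1 ≤ j → j < r → Relation.ReflTransGen (S.LSStep lam (a j)) (τ j) (τ (j + 1))

/-- The relative length `ℓ_x(w)`: the number of walls `Ker α`, for `α` a positive real root with
`α(x) ∈ ℤ`, separating the fundamental chamber `C` from `w C`. -/
def relLength (x : S.V) (w : S.W) : ℕ∞ :=
  Set.encard {M : Submodule ℝ S.V | ∃ α ∈ S.posRoots, (∃ k : ℤ, α x = k) ∧ M = LinearMap.ker α ∧
    ∀ u ∈ S.chamber, ∀ v ∈ S.chamber, α u * α (w • v) < 0}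

/-- The dual dimension `∑_{t > 0} ℓ_{π(t)}(w₋(t))`, a sum over `0 < t ≤ 1` with values in
`ℕ ∪ {∞}`, where `w₋(t)` is the smallest element with `π'₋(t) = w₋(t) λ`. -/
def ddim (lam : S.V) (π : ℝ → S.V) : ℕ∞ :=
  ⨆ F : Finset (Set.Ioc (0 : ℝ) 1),
    ∑ t ∈ F, S.relLength (π t) (S.minElt lam (S.leftTangent π t))

/-- The codimension `∑_{t < 1} ℓ_{π(t)}(w₊(t))`, a sum over `0 ≤ t < 1` with values in
`ℕ ∪ {∞}`, where `w₊(t)` is the smallest element with `π'₊(t) = w₊(t) λ`. -/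
def codim (lam : S.V) (π : ℝ → S.V) : ℕ∞ :=
  ⨆ F : Finset (Set.Ico (0 : ℝ) 1),
    ∑ t ∈ F, S.relLength (π t) (S.minElt lam (S.rightTangent π t))

end

end RootGeneratingSystem

/-! Everything reduces to counting positive roots. The minimal `w` with `wλ = ξ` has as inversions
exactly the positive roots negative on `ξ` (`invSet_minElt`), so its relative length at `x` counts
the positive roots integral at `x` and negative on `ξ` (`relLength_minElt`). Along a segment such a
root is a decreasing affine function of time, and its integral values are counted by a difference of
ceilings (ddim) or of floors (codim).

Sum: write `⌈z⌉ + ⌊z⌋ = 2z + sawtooth z`. The linear part yields `2ρ(λ - ν)`, because the sum of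
`α(v)` over the inversions of `w` is `ρ(v) - ρ(w⁻¹v)` (`invSum_apply`). The sawtooth is odd, so its
sums over inversion sets form a cocycle (`invSum_mul`); it is 1-periodic, so these sums do not
change along a Hecke chain. They telescope along the path and vanish at its ends, which lie in `Y`.

Difference: `⌈z⌉ - ⌊z⌋` is the indicator of non-integrality, so codim minus ddim is the sum, over
the break points, of the drop in the number of non-integral roots negative on the direction. By the
injection of `exists_injOn_negRoots` no drop is negative.

Equality: all the drops must vanish. A Hecke chain refines into steps lowering the integral count by
exactly one (`HeckeStep.reflTransGen_coverStep`); if the non-integral count is constant, they lower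
the full length by one, as LS steps do. Conversely an LS step lowers the full length by one and the
integral count by at least one, so it leaves the non-integral count unchanged. The two integrality
conditions agree because `π(a) - a ξ` stays in `Y`. -/

namespace RootGeneratingSystem

noncomputable section

variable {I X Y : Type*} [AddCommGroup X] [AddCommGroup Y] (S : RootGeneratingSystem I X Y)

/-! ### Simple roots and fundamental coweights -/

section Free
variable [Module.Free ℤ Y] [Module.Finite ℤ Y]

/-- Perfectness embeds `X` in the dual of `Y`, and flatness of `ℝ` over `ℤ` preserves independence
under base change. -/
theorem linearIndependent_simpleRoot : LinearIndependent ℝ S.simpleRoot := by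
  have h1 : LinearIndependent ℤ (fun i => S.pairing (S.root i)) :=
    S.free_root.map' S.pairing (LinearMap.ker_eq_bot.2 S.perfect.bijective_left.injective)
  have h2 := Module.Flat.linearIndependent_one_tmul (S := ℝ) h1
  have hbc : IsBaseChange ℝ ((TensorProduct.mk ℤ ℝ Y) 1) := TensorProduct.isBaseChange ℤ Y ℝ
  have h3 := h2.map' hbc.toDualBaseChange.toLinearMap (LinearEquiv.ker _)
  suffices key : S.simpleRoot =
      ⇑hbc.toDualBaseChange.toLinearMap ∘ fun i => 1 ⊗ₜ[ℤ] S.pairing (S.root i) by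
    rw [key]; exact h3
  funext i
  apply TensorProduct.AlgebraTensorModule.ext
  intro c y
  rw [simpleRoot, form_tmul]
  have h4 : c ⊗ₜ[ℤ] y = c • (1 ⊗ₜ[ℤ] y : ℝ ⊗[ℤ] Y) := by simp [TensorProduct.smul_tmul']
  have h5 := hbc.toDualBaseChange_tmul 1 (S.pairing (S.root i)) y
  rw [TensorProduct.mk_apply] at h5
  rw [h4, map_smul]
  simp [h5, mul_comm]

theorem exists_simpleRoot_eq [Finite I] (c : I → ℝ) :
    ∃ v : S.V, ∀ i, S.simpleRoot i v = c i := by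
  have h : LinearIndependent ℝ (fun i => (fun v : S.V => S.simpleRoot i v)) :=
    S.linearIndependent_simpleRoot.map' (LinearMap.ltoFun ℝ S.V ℝ ℝ)
      (LinearMap.ker_eq_bot.2 DFunLike.coe_injective)
  rw [← span_flip_eq_top_iff_linearIndependent] at h
  have hc : c ∈ Submodule.span ℝ (Set.range (flip fun i => (fun v : S.V => S.simpleRoot i v))) := by
    rw [h]; trivial
  let f : S.V →ₗ[ℝ] (I → ℝ) := LinearMap.pi S.simpleRoot
  have hle : Submodule.span ℝ (Set.range (flip fun i => (fun v : S.V => S.simpleRoot i v)))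
      ≤ LinearMap.range f := by
    rw [Submodule.span_le]
    rintro _ ⟨v, rfl⟩
    exact ⟨v, rfl⟩
  obtain ⟨v, hv⟩ := hle hc
  exact ⟨v, fun i => congrFun hv i⟩

variable [Finite I]

open Classical in
/-- Fundamental coweights: vectors dual to the simple roots. -/
def coweight (k : I) : S.V := (S.exists_simpleRoot_eq fun i => if i = k then 1 else 0).choose

theorem simpleRoot_coweight_self (k : I) : S.simpleRoot k (S.coweight k) = 1 := by
  classical
  have := (S.exists_simpleRoot_eq fun i => if i = k then 1 else 0).choose_spec k
  simpa [coweight] using this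

theorem simpleRoot_coweight_ne {i k : I} (h : i ≠ k) : S.simpleRoot i (S.coweight k) = 0 := by
  classical
  have := (S.exists_simpleRoot_eq fun i => if i = k then 1 else 0).choose_spec i
  simpa [coweight, h] using this

theorem chamber_nonempty : S.chamber.Nonempty := by
  obtain ⟨v, hv⟩ := S.exists_simpleRoot_eq fun _ => 1
  exact ⟨v, fun i => by rw [hv]; norm_num⟩

end Free

/-! ### The action of the Weyl group on linear forms -/

variable {S}

theorem rootAct_apply (w : S.W) (α : Module.Dual ℝ S.V) (v : S.V) :
    S.rootAct w α v = α (w⁻¹ • v) := rfl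

@[simp] theorem rootAct_one (α : Module.Dual ℝ S.V) : S.rootAct 1 α = α := by
  ext; simp [rootAct_apply]

theorem rootAct_mul (u w : S.W) (α : Module.Dual ℝ S.V) :
    S.rootAct (u * w) α = S.rootAct u (S.rootAct w α) := by
  apply LinearMap.ext; intro v
  simp only [rootAct_apply, mul_inv_rev, mul_smul]

@[simp] theorem rootAct_add (w : S.W) (α β : Module.Dual ℝ S.V) :
    S.rootAct w (α + β) = S.rootAct w α + S.rootAct w β := rfl

@[simp] theorem rootAct_neg (w : S.W) (α : Module.Dual ℝ S.V) :
    S.rootAct w (-α) = - S.rootAct w α := rfl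

@[simp] theorem rootAct_smul (w : S.W) (c : ℝ) (α : Module.Dual ℝ S.V) :
    S.rootAct w (c • α) = c • S.rootAct w α := rfl

@[simp] theorem rootAct_inv_rootAct (w : S.W) (α : Module.Dual ℝ S.V) :
    S.rootAct w⁻¹ (S.rootAct w α) = α := by
  rw [← rootAct_mul]; simp

@[simp] theorem rootAct_smul_apply (w : S.W) (α : Module.Dual ℝ S.V) (v : S.V) :
    S.rootAct w α (w • v) = α v := by
  rw [rootAct_apply, inv_smul_smul]

theorem rootAct_injective (w : S.W) : Function.Injective (S.rootAct w) :=
  Function.LeftInverse.injective (rootAct_inv_rootAct w)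

@[simp] theorem simpleReflection_mul_self (i : I) :
    S.simpleReflection i * S.simpleReflection i = 1 := by
  apply Subtype.ext
  apply LinearEquiv.ext
  intro v
  exact Module.involutive_reflection (S.simpleRoot_simpleCoroot_self i) v

@[simp] theorem simpleReflection_inv (i : I) :
    (S.simpleReflection i)⁻¹ = S.simpleReflection i :=
  inv_eq_of_mul_eq_one_left (simpleReflection_mul_self i)

@[simp] theorem simpleReflection_mul_cancel_left (i : I) (w : S.W) :
    S.simpleReflection i * (S.simpleReflection i * w) = w := by
  rw [← mul_assoc]; simp

@[simp] theorem mul_simpleReflection_cancel_right (i : I) (w : S.W) :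
    w * S.simpleReflection i * S.simpleReflection i = w := by
  rw [mul_assoc]; simp

theorem rootAct_simpleReflection (i : I) (α : Module.Dual ℝ S.V) :
    S.rootAct (S.simpleReflection i) α = α - α (S.simpleCoroot i) • S.simpleRoot i := by
  apply LinearMap.ext; intro v
  rw [rootAct_apply, simpleReflection_inv, simpleReflection_smul]
  simp [mul_comm]

@[simp] theorem rootAct_simpleReflection_self (i : I) :
    S.rootAct (S.simpleReflection i) (S.simpleRoot i) = - S.simpleRoot i := by
  rw [rootAct_simpleReflection, simpleRoot_simpleCoroot_self]; module

@[ext] theorem W_ext {u w : S.W} (h : ∀ v : S.V, u • v = w • v) : u = w :=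
  Subtype.ext (LinearEquiv.ext h)

theorem mul_simpleReflection_eq {u : S.W} {i k : I}
    (h : S.rootAct u (S.simpleRoot i) = S.simpleRoot k)
    (h' : u • S.simpleCoroot i = S.simpleCoroot k) :
    u * S.simpleReflection i = S.simpleReflection k * u := by
  apply W_ext
  intro v
  rw [mul_smul, mul_smul, simpleReflection_smul, simpleReflection_smul, smul_sub, smul_comm, h',
    ← h, rootAct_smul_apply]

/-! ### Words and length -/

variable (S) in
/-- The element of the Weyl group spelled by a word in the simple reflections. -/
def word (l : List I) : S.W := (l.map S.simpleReflection).prod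

@[simp] theorem word_nil : S.word [] = 1 := rfl
@[simp] theorem word_cons (i : I) (l : List I) :
    S.word (i :: l) = S.simpleReflection i * S.word l := by simp [word]
@[simp] theorem word_append (l l' : List I) : S.word (l ++ l') = S.word l * S.word l' := by
  simp [word]
theorem word_reverse (l : List I) : S.word l.reverse = (S.word l)⁻¹ := by
  induction l with
  | nil => simp
  | cons i l ih => simp [ih]

theorem exists_word (w : S.W) : ∃ l : List I, S.word l = w := by
  obtain ⟨w, hw⟩ := w
  induction hw using Subgroup.closure_induction with
  | mem x hx =>
    obtain ⟨i, rfl⟩ := hx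
    exact ⟨[i], by simp [word]; rfl⟩
  | one => exact ⟨[], rfl⟩
  | mul x y hx hy ihx ihy =>
    obtain ⟨l, hl⟩ := ihx
    obtain ⟨l', hl'⟩ := ihy
    exact ⟨l ++ l', by rw [word_append, hl, hl']; rfl⟩
  | inv x hx ih =>
    obtain ⟨l, hl⟩ := ih
    exact ⟨l.reverse, by rw [word_reverse, hl]; rfl⟩

theorem length_word_le (l : List I) : S.length (S.word l) ≤ l.length :=
  Nat.sInf_le ⟨l, rfl, rfl⟩

theorem exists_reduced_word (w : S.W) : ∃ l : List I, l.length = S.length w ∧ S.word l = w := by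
  obtain ⟨l, hl⟩ := exists_word w
  exact Nat.sInf_mem (s := {n : ℕ | ∃ l : List I, l.length = n ∧ (l.map S.simpleReflection).prod = w})
    ⟨_, l, rfl, hl⟩

@[simp] theorem length_one : S.length (1 : S.W) = 0 :=
  Nat.le_zero.1 (length_word_le (S := S) [])

theorem eq_one_of_length_eq_zero {w : S.W} (h : S.length w = 0) : w = 1 := by
  obtain ⟨l, hl, rfl⟩ := exists_reduced_word w
  rw [h, List.length_eq_zero_iff] at hl
  simp [hl]

theorem length_mul_le (u w : S.W) : S.length (u * w) ≤ S.length u + S.length w := by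
  obtain ⟨l, hl, rfl⟩ := exists_reduced_word u
  obtain ⟨l', hl', rfl⟩ := exists_reduced_word w
  rw [← word_append]
  refine (length_word_le _).trans ?_
  simp [hl, hl']

theorem length_inv_le (w : S.W) : S.length w⁻¹ ≤ S.length w := by
  obtain ⟨l, hl, rfl⟩ := exists_reduced_word w
  rw [← hl, ← word_reverse]
  exact (length_word_le _).trans (by simp)

@[simp] theorem length_inv (w : S.W) : S.length w⁻¹ = S.length w :=
  le_antisymm (length_inv_le w) (by simpa using length_inv_le w⁻¹)

theorem length_simpleReflection_le (i : I) : S.length (S.simpleReflection i) ≤ 1 := by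
  simpa using length_word_le (S := S) [i]

theorem length_le_length_mul_simpleReflection (w : S.W) (i : I) :
    S.length w ≤ S.length (w * S.simpleReflection i) + 1 := by
  have := length_mul_le (w * S.simpleReflection i) (S.simpleReflection i)
  rw [mul_simpleReflection_cancel_right] at this
  have := length_simpleReflection_le (S := S) i
  omega

theorem exists_length_mul_simpleReflection_lt {w : S.W} (h : w ≠ 1) :
    ∃ i, S.length (w * S.simpleReflection i) + 1 = S.length w := by
  obtain ⟨l, hl, rfl⟩ := exists_reduced_word w
  rcases List.eq_nil_or_concat l with rfl | ⟨l', i, rfl⟩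
  · simp at h
  · refine ⟨i, le_antisymm ?_ (length_le_length_mul_simpleReflection _ _)⟩
    have : S.word (l' ++ [i]) * S.simpleReflection i = S.word l' := by simp
    rw [List.concat_eq_append] at hl ⊢
    rw [this, ← hl]
    simpa using length_word_le (S := S) l'

/-! ### Rank two -/

variable (S) in
/-- The orbit of the simple root `αᵢ` under the group generated by `rᵢ` and `rⱼ`: coordinates of
`w αᵢ` and of the associated coroot. The numbers `b` and `d` symmetrize the Cartan matrix. -/
structure RankTwo (i j : I) (b d : ℤ) (w : S.W) (x y : ℤ) : Prop where
  root_eq : S.rootAct w (S.simpleRoot i) = (x : ℝ) • S.simpleRoot i + (y : ℝ) • S.simpleRoot j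
  coroot_eq : (b : ℝ) • (w • S.simpleCoroot i) =
    ((x * b : ℤ) : ℝ) • S.simpleCoroot i + ((y * d : ℤ) : ℝ) • S.simpleCoroot j
  coprime : IsCoprime x y
  norm_eq : b * x ^ 2 + b * S.A i j * x * y + d * y ^ 2 = b

theorem exists_symmetrizer (i j : I) (hij : i ≠ j) :
    ∃ b d : ℤ, 0 < b ∧ 0 < d ∧ b * S.A i j = d * S.A j i := by
  by_cases h : S.A i j = 0
  · exact ⟨1, 1, one_pos, one_pos, by rw [h, (S.kacMoody.zero_iff i j).1 h]⟩
  · have h' : S.A j i ≠ 0 := fun h0 => h ((S.kacMoody.zero_iff i j).2 h0)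
    have h1 := S.kacMoody.nonpos i j hij
    have h2 := S.kacMoody.nonpos j i hij.symm
    exact ⟨-S.A j i, -S.A i j, by omega, by omega, by ring⟩

namespace RankTwo

variable {i j : I} {b d : ℤ} {w : S.W} {x y : ℤ}

theorem one : S.RankTwo i j b d 1 1 0 where
  root_eq := by simp
  coroot_eq := by simp
  coprime := isCoprime_one_left
  norm_eq := by ring

theorem left (hbd : b * S.A i j = d * S.A j i) (h : S.RankTwo i j b d w x y) :
    S.RankTwo i j b d (S.simpleReflection i * w) (-x - S.A i j * y) y where
  root_eq := by
    rw [rootAct_mul, h.root_eq, rootAct_add, rootAct_smul, rootAct_smul,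
      rootAct_simpleReflection_self, rootAct_simpleReflection, simpleRoot_simpleCoroot]
    push_cast
    module
  coroot_eq := by
    rw [mul_smul, smul_comm (b : ℝ), h.coroot_eq, smul_add, ← smul_comm _ (S.simpleReflection i),
      ← smul_comm _ (S.simpleReflection i), simpleReflection_smul, simpleReflection_smul,
      simpleRoot_simpleCoroot_self, simpleRoot_simpleCoroot]
    have : (-x - S.A i j * y) * b = -(x * b) - y * (d * S.A j i) := by rw [← hbd]; ring
    rw [this]
    push_cast
    module
  coprime := by
    have := h.coprime.neg_left.add_mul_right_left (-S.A i j)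
    rwa [show -x + -S.A i j * y = -x - S.A i j * y by ring] at this
  norm_eq := by linear_combination h.norm_eq

theorem right (hbd : b * S.A i j = d * S.A j i) (h : S.RankTwo i j b d w x y) :
    S.RankTwo i j b d (S.simpleReflection j * w) x (-y - S.A j i * x) where
  root_eq := by
    rw [rootAct_mul, h.root_eq, rootAct_add, rootAct_smul, rootAct_smul,
      rootAct_simpleReflection_self, rootAct_simpleReflection, simpleRoot_simpleCoroot]
    push_cast
    module
  coroot_eq := by
    rw [mul_smul, smul_comm (b : ℝ), h.coroot_eq, smul_add, ← smul_comm _ (S.simpleReflection j),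
      ← smul_comm _ (S.simpleReflection j), simpleReflection_smul, simpleReflection_smul,
      simpleRoot_simpleCoroot_self, simpleRoot_simpleCoroot]
    have : (-y - S.A j i * x) * d = -(y * d) - x * (b * S.A i j) := by rw [hbd]; ring
    rw [this]
    push_cast
    module
  coprime := by
    have := h.coprime.neg_right.add_mul_left_right (-S.A j i)
    rwa [show -y + x * -S.A j i = -y - S.A j i * x by ring] at this
  norm_eq := by
    linear_combination h.norm_eq + (-2 * x * y - S.A j i * x ^ 2) * hbd

/-- Opposite signs would make the cross term non-negative, as `a_{i,j} ≤ 0`, and the quadratic form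
at least `b + d`; but its value is `b`. -/
theorem sign (hij : i ≠ j) (hb : 0 < b) (hd : 0 < d) (h : S.RankTwo i j b d w x y) :
    (0 ≤ x ∧ 0 ≤ y) ∨ (x ≤ 0 ∧ y ≤ 0) := by
  have hA := S.kacMoody.nonpos i j hij
  have hn := h.norm_eq
  have key : ∀ z : ℤ, z ≠ 0 → 1 ≤ z ^ 2 := fun z hz => by
    have := sq_pos_of_ne_zero hz; omega
  by_contra hc
  have hxy : x * y < 0 := by
    rcases lt_trichotomy x 0 with hx | hx | hx <;> rcases lt_trichotomy y 0 with hy | hy | hy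
    all_goals first | exact mul_neg_of_neg_of_pos hx hy | exact mul_neg_of_pos_of_neg hx hy | omega
  have hx : x ≠ 0 := by rintro rfl; simp at hxy
  have hy : y ≠ 0 := by rintro rfl; simp at hxy
  have h1 : b * 1 ≤ b * x ^ 2 := mul_le_mul_of_nonneg_left (key x hx) hb.le
  have h2 : d * 1 ≤ d * y ^ 2 := mul_le_mul_of_nonneg_left (key y hy) hd.le
  have h3 : 0 ≤ b * (S.A i j * (x * y)) :=
    mul_nonneg hb.le (mul_nonneg_of_nonpos_of_nonpos hA hxy.le)
  have h4 : b * S.A i j * x * y = b * (S.A i j * (x * y)) := by ring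
  omega

end RankTwo

/-- Exchange condition in rank two. -/
theorem rankTwo_exchange {i j : I} (hij : i ≠ j) {b d : ℤ} (hb : 0 < b) (hd : 0 < d)
    (hbd : b * S.A i j = d * S.A j i) (l : List I) (hl : ∀ k ∈ l, k = i ∨ k = j) :
    (∃ x y : ℤ, 0 ≤ x ∧ 0 ≤ y ∧ S.RankTwo i j b d (S.word l) x y) ∨
      ∃ l' : List I, l'.length + 1 = l.length ∧ S.word l' = S.word l * S.simpleReflection i := by
  induction l with
  | nil => exact Or.inl ⟨1, 0, zero_le_one, le_rfl, RankTwo.one⟩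
  | cons k l ih =>
    rcases ih (fun m hm => hl m (List.mem_cons_of_mem _ hm)) with ⟨x, y, hx, hy, h⟩ | ⟨l', h1, h2⟩
    · rcases hl k List.mem_cons_self with rfl | rfl
      · have h' := h.left hbd
        rcases h'.sign hij hb hd with h0 | h0
        · exact Or.inl ⟨_, _, h0.1, h0.2, by rw [word_cons]; exact h'⟩
        · refine Or.inr ⟨l, rfl, ?_⟩
          -- Only `x` changes here, so a change of sign forces `y = 0`, and coprimality gives `x =
          -- 1`: the shorter word fixes the root and its coroot, hence commutes with the reflection,
          -- and the two letters cancel.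
          obtain rfl : y = 0 := by omega
          have hx1 : x = 1 := by
            have := Int.isUnit_iff.1 (isCoprime_zero_right.1 h.coprime); omega
          subst hx1
          have hr : S.rootAct (S.word l) (S.simpleRoot k) = S.simpleRoot k := by
            rw [h.root_eq]; simp
          have hc : S.word l • S.simpleCoroot k = S.simpleCoroot k := by
            have := h.coroot_eq
            simp only [one_mul, zero_mul, Int.cast_zero, zero_smul, add_zero] at this
            exact smul_right_injective _ (by exact_mod_cast hb.ne') this
          rw [word_cons, mul_assoc, mul_simpleReflection_eq hr hc]
          simp
      · have h' := h.right hbd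
        rcases h'.sign hij hb hd with h0 | h0
        · exact Or.inl ⟨_, _, h0.1, h0.2, by rw [word_cons]; exact h'⟩
        · refine Or.inr ⟨l, rfl, ?_⟩
          -- Now only `y` changes, so `x = 0` and `y = 1`; the norm gives `d = b`, and the shorter
          -- word carries root and coroot of `i` to those of `k`.
          obtain rfl : x = 0 := by omega
          have hy1 : y = 1 := by
            have := Int.isUnit_iff.1 (isCoprime_zero_left.1 h.coprime); omega
          subst hy1
          have hdb : d = b := by have := h.norm_eq; simpa using this
          subst hdb
          have hr : S.rootAct (S.word l) (S.simpleRoot i) = S.simpleRoot k := by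
            rw [h.root_eq]; simp
          have hc : S.word l • S.simpleCoroot i = S.simpleCoroot k := by
            have := h.coroot_eq
            simp only [one_mul, zero_mul, Int.cast_zero, zero_smul, zero_add] at this
            exact smul_right_injective _ (by exact_mod_cast hb.ne') this
          rw [word_cons, mul_assoc, mul_simpleReflection_eq hr hc]
          simp
    · exact Or.inr ⟨k :: l', by simp [h1], by rw [word_cons, word_cons, h2, mul_assoc]⟩

/-! ### Positivity of roots -/

/-- Induction on the length. Split `w = v u` with `u` in the group generated by `rᵢ` and a right
descent `rⱼ` of `w`. For `v` as short as possible, `v αᵢ` and `v αⱼ` are positive by induction, and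
`u αᵢ` is a non-negative combination of `αᵢ` and `αⱼ` by the rank two case. -/
theorem rootAct_mem_posCone_of_length_le (w : S.W) (i : I)
    (h : S.length w ≤ S.length (w * S.simpleReflection i)) :
    S.rootAct w (S.simpleRoot i) ∈ AddSubmonoid.closure (Set.range S.simpleRoot) := by
  induction hn : S.length w using Nat.strong_induction_on generalizing w i with
  | _ n ih =>
  by_cases hw : w = 1
  · subst hw
    rw [rootAct_one]
    exact AddSubmonoid.subset_closure ⟨i, rfl⟩
  obtain ⟨j, hj⟩ := exists_length_mul_simpleReflection_lt hw
  have hij : i ≠ j := by rintro rfl; omega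
  -- Factorizations whose lengths add up to that of `w`. A shortest `v` is shortened on the right by
  -- neither `rᵢ` nor `rⱼ`, since such a letter could be moved into the word.
  let P : ℕ → Prop := fun m => ∃ (v : S.W) (l : List I), S.length v = m ∧ (∀ k ∈ l, k = i ∨ k = j) ∧
    w = v * S.word l ∧ S.length v + l.length = n
  have hP : ∃ m, P m := ⟨_, w * S.simpleReflection j, [j], rfl, by simp, by simp, by simp; omega⟩
  classical
  obtain ⟨v, l, hvm, hl, hwv, hlen⟩ := Nat.find_spec hP
  have hvn : S.length v < n := by
    have := Nat.find_min' hP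
      (⟨w * S.simpleReflection j, [j], rfl, by simp, by simp, by simp; omega⟩ : P _)
    omega
  have hv : ∀ k, k = i ∨ k = j → S.length v ≤ S.length (v * S.simpleReflection k) := by
    intro k hk
    by_contra hlt
    have hlt' : S.length (v * S.simpleReflection k) < Nat.find hP := by omega
    refine Nat.find_min hP hlt' ⟨v * S.simpleReflection k, k :: l, rfl, ?_, ?_, ?_⟩
    · rintro m hm
      rcases List.mem_cons.1 hm with rfl | hm
      · exact hk
      · exact hl m hm
    · rw [word_cons, mul_assoc, simpleReflection_mul_cancel_left, hwv]
    · have := length_le_length_mul_simpleReflection v k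
      simp only [List.length_cons]
      omega
  have hvi := ih _ hvn v i (hv i (Or.inl rfl)) rfl
  have hvj := ih _ hvn v j (hv j (Or.inr rfl)) rfl
  obtain ⟨b, d, hb, hd, hbd⟩ := exists_symmetrizer (S := S) i j hij
  rcases rankTwo_exchange hij hb hd hbd l hl with ⟨x, y, hx, hy, hxy⟩ | ⟨l', h1, h2⟩
  · rw [hwv, rootAct_mul, hxy.root_eq, rootAct_add, rootAct_smul, rootAct_smul]
    lift x to ℕ using hx
    lift y to ℕ using hy
    have := add_mem (nsmul_mem hvi x) (nsmul_mem hvj y)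
    convert this using 2 <;> simp [← Nat.cast_smul_eq_nsmul ℝ]
  -- The exchange would spell `w rᵢ` with fewer than `n` letters, against `h`.
  · have h3 : w * S.simpleReflection i = v * S.word l' := by rw [h2, hwv, mul_assoc]
    have := length_mul_le v (S.word l')
    have := length_word_le (S := S) l'
    rw [h3] at h
    omega

theorem pos_or_neg_of_mem_realRoots {β : Module.Dual ℝ S.V} (h : β ∈ S.realRoots) :
    β ∈ S.posRoots ∨ -β ∈ S.posRoots := by
  obtain ⟨w, i, rfl⟩ := h
  rcases le_total (S.length w) (S.length (w * S.simpleReflection i)) with hw | hw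
  · exact Or.inl ⟨⟨w, i, rfl⟩, rootAct_mem_posCone_of_length_le w i hw⟩
  · have key : -S.rootAct w (S.simpleRoot i) =
        S.rootAct (w * S.simpleReflection i) (S.simpleRoot i) := by
      rw [rootAct_mul]; simp
    rw [key]
    exact Or.inr ⟨⟨_, i, rfl⟩, rootAct_mem_posCone_of_length_le _ i (by simpa using hw)⟩

/-! ### Real roots -/

theorem simpleRoot_mem_realRoots (i : I) : S.simpleRoot i ∈ S.realRoots := ⟨1, i, by simp⟩

theorem simpleRoot_mem_posRoots (i : I) : S.simpleRoot i ∈ S.posRoots :=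
  ⟨simpleRoot_mem_realRoots i, AddSubmonoid.subset_closure ⟨i, rfl⟩⟩

theorem rootAct_mem_realRoots (w : S.W) {β : Module.Dual ℝ S.V} (h : β ∈ S.realRoots) :
    S.rootAct w β ∈ S.realRoots := by
  obtain ⟨u, i, rfl⟩ := h
  exact ⟨w * u, i, (rootAct_mul _ _ _).symm⟩

theorem ne_zero_of_mem_realRoots {β : Module.Dual ℝ S.V} (h : β ∈ S.realRoots) : β ≠ 0 := by
  obtain ⟨w, i, rfl⟩ := h
  intro h0
  have := S.simpleRoot_simpleCoroot_self i
  rw [← rootAct_smul_apply w, h0] at this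
  simp at this

theorem posRoots_nonneg {β : Module.Dual ℝ S.V} (h : β ∈ S.posRoots) {u : S.V}
    (hu : u ∈ S.closedChamber) : 0 ≤ β u := by
  refine AddSubmonoid.closure_induction (motive := fun α _ => 0 ≤ α u) ?_ ?_ ?_ h.2
  · rintro _ ⟨i, rfl⟩; exact hu i
  · simp
  · intro a b _ _ ha hb; exact add_nonneg ha hb

theorem posRoots_pos {β : Module.Dual ℝ S.V} (h : β ∈ S.posRoots) {u : S.V}
    (hu : u ∈ S.chamber) : 0 < β u := by
  have key : β = 0 ∨ 0 < β u := by
    refine AddSubmonoid.closure_induction (motive := fun α _ => α = 0 ∨ 0 < α u) ?_ ?_ ?_ h.2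
    · rintro _ ⟨i, rfl⟩; exact Or.inr (hu i)
    · exact Or.inl rfl
    · rintro a b _ _ (rfl | ha) (rfl | hb)
      · simp
      · right; simpa using hb
      · right; simpa using ha
      · right; exact add_pos ha hb
  exact key.resolve_left (ne_zero_of_mem_realRoots h.1)

theorem exists_int_of_mem_realRoots {β : Module.Dual ℝ S.V} (h : β ∈ S.realRoots) {v : S.V}
    (hv : ∀ i, ∃ n : ℤ, S.simpleRoot i v = n) : ∃ n : ℤ, β v = n := by
  have key : ∀ α ∈ S.posRoots, ∃ n : ℤ, α v = n := by
    intro α hα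
    refine AddSubmonoid.closure_induction (motive := fun (α : Module.Dual ℝ S.V) _ => ∃ n : ℤ, α v = n) ?_ ?_ ?_ hα.2
    · rintro _ ⟨i, rfl⟩; exact hv i
    · exact ⟨0, by simp⟩
    · rintro a b _ _ ⟨m, hm⟩ ⟨n, hn⟩
      exact ⟨m + n, by simp [hm, hn]⟩
  rcases pos_or_neg_of_mem_realRoots h with h | h
  · exact key _ h
  · obtain ⟨n, hn⟩ := key _ h
    exact ⟨-n, by push_cast; rw [← hn]; simp⟩

theorem exists_int_of_mem_range_ofY {β : Module.Dual ℝ S.V} (h : β ∈ S.realRoots) {v : S.V}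
    (hv : v ∈ Set.range S.ofY) : ∃ n : ℤ, β v = n := by
  obtain ⟨y, rfl⟩ := hv
  refine exists_int_of_mem_realRoots h fun i => ⟨S.pairing (S.root i) y, ?_⟩
  have := S.form_tmul (S.root i) 1 y
  rw [mul_one] at this
  exact this

theorem simpleCoroot_mem_range_ofY (i : I) : S.simpleCoroot i ∈ Set.range S.ofY := ⟨_, rfl⟩

theorem smul_mem_range_ofY (w : S.W) {v : S.V} (hv : v ∈ Set.range S.ofY) :
    w • v ∈ Set.range S.ofY := by
  obtain ⟨l, rfl⟩ := exists_word w
  induction l with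
  | nil => simpa using hv
  | cons i l ih =>
    rw [word_cons, mul_smul, simpleReflection_smul]
    obtain ⟨n, hn⟩ := exists_int_of_mem_range_ofY (simpleRoot_mem_realRoots i) ih
    rw [hn, Int.cast_smul_eq_zsmul]
    exact AddSubgroup.sub_mem (AddMonoidHom.range S.ofY) ih
      (AddSubgroup.zsmul_mem _ (simpleCoroot_mem_range_ofY i) n)

section Free
variable [Module.Free ℤ Y] [Module.Finite ℤ Y] [Finite I]

theorem coweight_mem_closedChamber (k : I) : S.coweight k ∈ S.closedChamber := by
  intro i
  by_cases h : i = k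
  · subst h; rw [simpleRoot_coweight_self]; norm_num
  · rw [simpleRoot_coweight_ne S h]

theorem exists_int_coweight {β : Module.Dual ℝ S.V} (h : β ∈ S.realRoots) (k : I) :
    ∃ n : ℤ, β (S.coweight k) = n := by
  refine exists_int_of_mem_realRoots h fun i => ?_
  by_cases h : i = k
  · subst h; exact ⟨1, by rw [simpleRoot_coweight_self]; norm_num⟩
  · exact ⟨0, by rw [simpleRoot_coweight_ne S h]; norm_num⟩

theorem neg_mem_posRoots_iff {β : Module.Dual ℝ S.V} (h : β ∈ S.realRoots) :
    -β ∈ S.posRoots ↔ β ∉ S.posRoots := by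
  obtain ⟨u, hu⟩ := S.chamber_nonempty
  refine ⟨fun h1 h2 => ?_, (pos_or_neg_of_mem_realRoots h).resolve_left⟩
  have := posRoots_pos h1 hu
  have := posRoots_pos h2 hu
  simp at *
  linarith

theorem eq_sum_coweight [Fintype I] {β : Module.Dual ℝ S.V} (h : β ∈ S.posRoots) :
    β = ∑ k, β (S.coweight k) • S.simpleRoot k := by
  refine AddSubmonoid.closure_induction
    (motive := fun α _ => α = ∑ k, α (S.coweight k) • S.simpleRoot k) ?_ ?_ ?_ h.2
  · rintro _ ⟨i, rfl⟩
    rw [Finset.sum_eq_single i]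
    · rw [simpleRoot_coweight_self, one_smul]
    · intro k _ hk
      rw [simpleRoot_coweight_ne S hk.symm, zero_smul]
    · simp
  · simp
  · intro a b _ _ ha hb
    conv_lhs => rw [ha, hb]
    simp [add_smul, Finset.sum_add_distrib]

theorem eq_smul_simpleRoot {β : Module.Dual ℝ S.V} (h : β ∈ S.posRoots) {i : I}
    (h0 : ∀ k, k ≠ i → β (S.coweight k) = 0) : β = β (S.coweight i) • S.simpleRoot i := by
  have := Fintype.ofFinite I
  conv_lhs => rw [eq_sum_coweight h]
  refine Finset.sum_eq_single i (fun k _ hk => ?_) (by simp)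
  rw [h0 k hk, zero_smul]

theorem exists_int_of_smul_mem_realRoots {β : Module.Dual ℝ S.V} (hβ : β ∈ S.realRoots) {c : ℝ}
    (h : c • β ∈ S.realRoots) : ∃ n : ℤ, c = n := by
  obtain ⟨w, i, rfl⟩ := hβ
  have h1 := rootAct_mem_realRoots w⁻¹ h
  rw [rootAct_smul, rootAct_inv_rootAct] at h1
  obtain ⟨n, hn⟩ := exists_int_coweight h1 i
  exact ⟨n, by simpa [simpleRoot_coweight_self] using hn⟩

/-- Both `c` and its inverse are integers, and `c > 0`. -/
theorem eq_of_smul_mem_posRoots {β : Module.Dual ℝ S.V} (hβ : β ∈ S.posRoots) {c : ℝ}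
    (h : c • β ∈ S.posRoots) : c • β = β := by
  obtain ⟨u, hu⟩ := S.chamber_nonempty
  have h1 := posRoots_pos hβ hu
  have h2 := posRoots_pos h hu
  rw [LinearMap.smul_apply, smul_eq_mul] at h2
  have hc : 0 < c := pos_of_mul_pos_left h2 h1.le
  obtain ⟨m, hm⟩ := exists_int_of_smul_mem_realRoots hβ.1 h.1
  obtain ⟨n, hn⟩ := exists_int_of_smul_mem_realRoots (c := c⁻¹) h.1
    (by rw [inv_smul_smul₀ hc.ne']; exact hβ.1)
  have hmn : m * n = 1 := by
    have : c * c⁻¹ = 1 := mul_inv_cancel₀ hc.ne'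
    rw [hn, hm] at this
    exact_mod_cast this
  have hm0 : 0 < m := by rw [hm] at hc; exact_mod_cast hc
  have : m = 1 := by
    rcases Int.eq_one_or_neg_one_of_mul_eq_one hmn with h | h <;> omega
  rw [hm, this]; simp

/-- Makes walls and positive roots correspond bijectively, so that counting walls is counting roots.
-/
theorem eq_of_ker_eq {β γ : Module.Dual ℝ S.V} (hβ : β ∈ S.posRoots) (hγ : γ ∈ S.posRoots)
    (h : LinearMap.ker β = LinearMap.ker γ) : β = γ := by
  obtain ⟨c, hc⟩ : ∃ c : ℝ, c • γ = β := by
    obtain ⟨u, hu⟩ := S.chamber_nonempty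
    have h0 := (posRoots_pos hγ hu).ne'
    refine ⟨β u / γ u, LinearMap.ext fun v => ?_⟩
    have h1 : v - (γ v / γ u) • u ∈ LinearMap.ker γ := by
      simp [h0]
    rw [← h] at h1
    simp only [LinearMap.mem_ker, map_sub, map_smul, smul_eq_mul] at h1
    rw [LinearMap.smul_apply, smul_eq_mul]
    field_simp at h1 ⊢
    linarith
  rw [← hc] at hβ ⊢
  exact eq_of_smul_mem_posRoots hγ hβ

/-- A positive root other than `αᵢ` has a positive coefficient on another simple root. Subtracting a
multiple of `αᵢ` keeps that coefficient, and the coefficients of a real root all have one sign. -/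
theorem sub_smul_simpleRoot_mem_posRoots {γ : Module.Dual ℝ S.V} (h : γ ∈ S.posRoots) {i : I}
    (hne : γ ≠ S.simpleRoot i) {c : ℝ} (hc : γ - c • S.simpleRoot i ∈ S.realRoots) :
    γ - c • S.simpleRoot i ∈ S.posRoots := by
  obtain ⟨k, hk, hk0⟩ : ∃ k, k ≠ i ∧ γ (S.coweight k) ≠ 0 := by
    by_contra! hc
    have h1 := eq_smul_simpleRoot h hc
    rw [h1] at h
    exact hne (h1.trans (eq_of_smul_mem_posRoots (simpleRoot_mem_posRoots i) h))
  refine (pos_or_neg_of_mem_realRoots hc).resolve_right fun h2 => ?_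
  have h3 := posRoots_nonneg h2 (coweight_mem_closedChamber k)
  have h4 := posRoots_nonneg h (coweight_mem_closedChamber k)
  simp [simpleRoot_coweight_ne S hk.symm] at h3
  exact hk0 (le_antisymm h3 h4)

theorem rootAct_simpleReflection_mem_posRoots {γ : Module.Dual ℝ S.V} (h : γ ∈ S.posRoots) {i : I}
    (hne : γ ≠ S.simpleRoot i) : S.rootAct (S.simpleReflection i) γ ∈ S.posRoots := by
  have h1 := rootAct_mem_realRoots (S.simpleReflection i) h.1
  rw [rootAct_simpleReflection] at h1 ⊢
  exact sub_smul_simpleRoot_mem_posRoots h hne h1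

end Free

/-! ### Inversion sets -/

variable (S) in
/-- The positive roots `γ` such that `w⁻¹ γ` is negative. -/
def invSet (w : S.W) : Set (Module.Dual ℝ S.V) :=
  {γ | γ ∈ S.posRoots ∧ S.rootAct w⁻¹ γ ∉ S.posRoots}

@[simp] theorem invSet_one : S.invSet 1 = ∅ := by
  ext γ; simp [invSet]

/-- The sum of a function over an inversion set. -/
def invSum (c : Module.Dual ℝ S.V → ℝ) (w : S.W) : ℝ := ∑ᶠ γ ∈ S.invSet w, c γ

@[simp] theorem invSum_one (c : Module.Dual ℝ S.V → ℝ) : invSum c (1 : S.W) = 0 := by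
  simp [invSum]

section Free
variable [Module.Free ℤ Y] [Module.Finite ℤ Y] [Finite I]

theorem invSet_simpleReflection_mul {w : S.W} {i : I}
    (h : S.rootAct w⁻¹ (S.simpleRoot i) ∈ S.posRoots) :
    S.invSet (S.simpleReflection i * w) =
      insert (S.simpleRoot i) (S.rootAct (S.simpleReflection i) '' S.invSet w) := by
  ext γ
  have hγ : S.rootAct (S.simpleReflection i * w)⁻¹ γ =
      S.rootAct w⁻¹ (S.rootAct (S.simpleReflection i) γ) := by
    rw [mul_inv_rev, simpleReflection_inv, rootAct_mul]
  have hmem : γ ∈ S.rootAct (S.simpleReflection i) '' S.invSet w ↔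
      S.rootAct (S.simpleReflection i) γ ∈ S.invSet w := by
    constructor
    · rintro ⟨δ, hδ, rfl⟩
      rwa [← rootAct_mul, simpleReflection_mul_self, rootAct_one]
    · intro h
      exact ⟨_, h, by rw [← rootAct_mul, simpleReflection_mul_self, rootAct_one]⟩
  rw [Set.mem_insert_iff, hmem]
  by_cases hi : γ = S.simpleRoot i
  · subst hi
    simp only [true_or, iff_true]
    refine ⟨simpleRoot_mem_posRoots i, ?_⟩
    rw [hγ, rootAct_simpleReflection_self, rootAct_neg, neg_mem_posRoots_iff h.1]
    exact not_not.2 h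
  · simp only [hi, false_or]
    constructor
    · rintro ⟨h1, h2⟩
      rw [hγ] at h2
      exact ⟨rootAct_simpleReflection_mem_posRoots h1 hi, h2⟩
    · rintro ⟨h1, h2⟩
      have h3 := rootAct_simpleReflection_mem_posRoots (i := i) h1 (fun h3 => h2 (by rwa [h3]))
      rw [← rootAct_mul, simpleReflection_mul_self, rootAct_one] at h3
      exact ⟨h3, by rwa [hγ]⟩

theorem simpleRoot_notMem_image {w : S.W} {i : I} :
    S.simpleRoot i ∉ S.rootAct (S.simpleReflection i) '' S.invSet w := by
  rintro ⟨δ, hδ, h⟩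
  have h1 : S.rootAct (S.simpleReflection i) δ ∈ S.posRoots := h ▸ simpleRoot_mem_posRoots i
  by_cases h2 : δ = S.simpleRoot i
  · subst h2
    rw [rootAct_simpleReflection_self, neg_mem_posRoots_iff hδ.1.1] at h1
    exact h1 hδ.1
  · have h3 : δ = - S.simpleRoot i := by
      have := congrArg (S.rootAct (S.simpleReflection i)) h
      rwa [← rootAct_mul, simpleReflection_mul_self, rootAct_one,
        rootAct_simpleReflection_self] at this
    have h4 := hδ.1
    rw [h3, neg_mem_posRoots_iff (simpleRoot_mem_realRoots i)] at h4
    exact h4 (simpleRoot_mem_posRoots i)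

theorem rootAct_inv_simpleReflection_mul_mem {w : S.W} {i : I}
    (h : S.rootAct w⁻¹ (S.simpleRoot i) ∉ S.posRoots) :
    S.rootAct (S.simpleReflection i * w)⁻¹ (S.simpleRoot i) ∈ S.posRoots := by
  rw [mul_inv_rev, simpleReflection_inv, rootAct_mul, rootAct_simpleReflection_self, rootAct_neg]
  exact (neg_mem_posRoots_iff (rootAct_mem_realRoots _ (simpleRoot_mem_realRoots i))).2 h

theorem invSet_finite (w : S.W) : (S.invSet w).Finite := by
  obtain ⟨l, rfl⟩ := exists_word w
  induction l with
  | nil => simp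
  | cons i l ih =>
    rw [word_cons]
    by_cases h : S.rootAct (S.word l)⁻¹ (S.simpleRoot i) ∈ S.posRoots
    · rw [invSet_simpleReflection_mul h]
      exact (ih.image _).insert _
    · have h1 := invSet_simpleReflection_mul (rootAct_inv_simpleReflection_mul_mem h)
      rw [simpleReflection_mul_cancel_left] at h1
      rw [h1] at ih
      exact (ih.subset (Set.subset_insert _ _)).of_finite_image (rootAct_injective _).injOn

theorem ncard_invSet_simpleReflection_mul {w : S.W} {i : I}
    (h : S.rootAct w⁻¹ (S.simpleRoot i) ∈ S.posRoots) :
    (S.invSet (S.simpleReflection i * w)).ncard = (S.invSet w).ncard + 1 := by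
  rw [invSet_simpleReflection_mul h, Set.ncard_insert_of_notMem simpleRoot_notMem_image
    ((invSet_finite w).image _), Set.ncard_image_of_injective _ (rootAct_injective _)]

theorem ncard_invSet (w : S.W) : (S.invSet w).ncard = S.length w := by
  induction hn : S.length w generalizing w with
  | zero => rw [eq_one_of_length_eq_zero hn]; simp
  | succ n ih =>
    have hw : w⁻¹ ≠ 1 := by rintro h; rw [inv_eq_one] at h; subst h; simp at hn
    obtain ⟨i, hi⟩ := exists_length_mul_simpleReflection_lt hw
    rw [length_inv] at hi
    have hl : S.length (S.simpleReflection i * w) = S.length (w⁻¹ * S.simpleReflection i) := by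
      rw [← length_inv (S.simpleReflection i * w), mul_inv_rev, simpleReflection_inv]
    have h1 : S.rootAct (S.simpleReflection i * w)⁻¹ (S.simpleRoot i) ∈ S.posRoots := by
      refine ⟨⟨_, i, rfl⟩, rootAct_mem_posCone_of_length_le _ i ?_⟩
      rw [mul_inv_rev, simpleReflection_inv, mul_simpleReflection_cancel_right, length_inv]
      omega
    have h2 := ncard_invSet_simpleReflection_mul h1
    rw [simpleReflection_mul_cancel_left, ih (S.simpleReflection i * w) (by omega)] at h2
    exact h2

theorem eq_one_of_invSet_eq_empty {w : S.W} (h : S.invSet w = ∅) : w = 1 :=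
  eq_one_of_length_eq_zero (by rw [← ncard_invSet, h, Set.ncard_empty])

/-- If `γ` is positive and `u⁻¹wγ` is negative, then `wγ` or `-wγ` is an inversion of exactly one of
`u` and `w`. -/
theorem eq_of_invSet_eq {u w : S.W} (h : S.invSet u = S.invSet w) : u = w := by
  have : u⁻¹ * w = 1 := by
    rw [← inv_eq_one]
    apply eq_one_of_invSet_eq_empty
    rw [Set.eq_empty_iff_forall_notMem]
    rintro γ ⟨h1, h2⟩
    rw [inv_inv, rootAct_mul] at h2
    by_cases h3 : S.rootAct w γ ∈ S.posRoots
    · have h4 : S.rootAct w γ ∈ S.invSet u := ⟨h3, h2⟩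
      rw [h] at h4
      exact h4.2 (by simpa using h1)
    · rw [← neg_mem_posRoots_iff (rootAct_mem_realRoots _ h1.1)] at h3
      have h4 : -S.rootAct w γ ∈ S.invSet w := by
        refine ⟨h3, ?_⟩
        rw [rootAct_neg, rootAct_inv_rootAct, neg_mem_posRoots_iff h1.1]
        exact not_not.2 h1
      rw [← h] at h4
      have h5 := h4.2
      rw [rootAct_neg, neg_mem_posRoots_iff (rootAct_mem_realRoots _ (rootAct_mem_realRoots _ h1.1))]
        at h5
      exact h5 h2
  exact inv_mul_eq_one.1 this

/-! ### Sums over inversion sets -/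

/-- Oddness of `c` removes any condition on lengths: when `rᵢ` shortens `w`, the formula for `rᵢ w`
is read backwards and `c(-αᵢ) = -c(αᵢ)` corrects the sign. -/
theorem invSum_simpleReflection_mul {c : Module.Dual ℝ S.V → ℝ} (hc : ∀ α, c (-α) = - c α)
    (i : I) (w : S.W) : invSum c (S.simpleReflection i * w) =
      c (S.simpleRoot i) + invSum (fun α => c (S.rootAct (S.simpleReflection i) α)) w := by
  have key : ∀ (c : Module.Dual ℝ S.V → ℝ) (w : S.W),
      S.rootAct w⁻¹ (S.simpleRoot i) ∈ S.posRoots → invSum c (S.simpleReflection i * w) =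
      c (S.simpleRoot i) + invSum (fun α => c (S.rootAct (S.simpleReflection i) α)) w := by
    intro c w h
    rw [invSum, invSet_simpleReflection_mul h, finsum_mem_insert _ simpleRoot_notMem_image
      ((invSet_finite w).image _), finsum_mem_image (rootAct_injective _).injOn, invSum]
  by_cases h : S.rootAct w⁻¹ (S.simpleRoot i) ∈ S.posRoots
  · exact key c w h
  · have h1 := key (fun α => c (S.rootAct (S.simpleReflection i) α)) _
      (rootAct_inv_simpleReflection_mul_mem h)
    simp only [simpleReflection_mul_cancel_left, rootAct_simpleReflection_self, ← rootAct_mul,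
      simpleReflection_mul_self, rootAct_one, hc] at h1
    rw [h1]; ring

theorem invSum_mul {c : Module.Dual ℝ S.V → ℝ} (hc : ∀ α, c (-α) = - c α) (u w : S.W) :
    invSum c (u * w) = invSum c u + invSum (fun α => c (S.rootAct u α)) w := by
  obtain ⟨l, rfl⟩ := exists_word u
  induction l generalizing c with
  | nil => simp
  | cons i l ih =>
    rw [word_cons, mul_assoc, invSum_simpleReflection_mul hc, invSum_simpleReflection_mul hc,
      ih (c := fun α => c (S.rootAct (S.simpleReflection i) α)) (fun α => by simp [hc])]
    simp only [rootAct_mul]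
    ring

/-- Both sides obey the same recursion on a left factor `rᵢ`, with increment `αᵢ(v)` because
`ρ(αᵢ^∨) = 1`. -/
theorem invSum_apply {ρ : Module.Dual ℝ S.V} (hρ : ∀ i, ρ (S.simpleCoroot i) = 1) (w : S.W)
    (v : S.V) : invSum (fun α => α v) w = ρ v - ρ (w⁻¹ • v) := by
  obtain ⟨l, rfl⟩ := exists_word w
  induction l generalizing v with
  | nil => simp
  | cons i l ih =>
    rw [word_cons, invSum_simpleReflection_mul (by simp)]
    simp only [rootAct_apply, simpleReflection_inv]
    rw [ih, mul_inv_rev, mul_smul, simpleReflection_inv, simpleReflection_smul, map_sub, map_smul,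
      hρ]
    simp only [smul_eq_mul, mul_one]
    ring

end Free

/-! ### Reflections -/

namespace IsReflection

variable {β : Module.Dual ℝ S.V} {r : S.W}

theorem mem_realRoots (h : S.IsReflection β r) : β ∈ S.realRoots := by
  obtain ⟨w, i, h, -⟩ := h
  exact ⟨w, i, h⟩

theorem mul_self (h : S.IsReflection β r) : r * r = 1 := by
  obtain ⟨w, i, -, rfl⟩ := h
  simp [mul_assoc]

theorem smul_smul (h : S.IsReflection β r) (v : S.V) : r • r • v = v := by
  rw [← mul_smul, h.mul_self, one_smul]

theorem inv_eq (h : S.IsReflection β r) : r⁻¹ = r := inv_eq_of_mul_eq_one_left h.mul_self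

theorem rootAct_rootAct (h : S.IsReflection β r) (γ : Module.Dual ℝ S.V) :
    S.rootAct r (S.rootAct r γ) = γ := by
  rw [← rootAct_mul, h.mul_self, rootAct_one]

theorem rootAct_apply (h : S.IsReflection β r) (γ : Module.Dual ℝ S.V) (v : S.V) :
    S.rootAct r γ v = γ (r • v) := by
  rw [RootGeneratingSystem.rootAct_apply, h.inv_eq]

theorem exists_coroot (h : S.IsReflection β r) : ∃ b ∈ Set.range S.ofY, β b = 2 ∧
    (∀ v, r • v = v - β v • b) ∧ ∀ γ, S.rootAct r γ = γ - γ b • β := by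
  have hr := h.inv_eq
  obtain ⟨w, i, hβ, rfl⟩ := h
  have key : ∀ v, (w * S.simpleReflection i * w⁻¹) • v = v - β v • (w • S.simpleCoroot i) := by
    intro v
    rw [mul_smul, mul_smul, simpleReflection_smul, smul_sub, smul_inv_smul, smul_comm w, hβ]
    rfl
  refine ⟨w • S.simpleCoroot i, smul_mem_range_ofY w (simpleCoroot_mem_range_ofY i), ?_, key, ?_⟩
  · rw [hβ, rootAct_smul_apply, simpleRoot_simpleCoroot_self]
  · intro γ
    apply LinearMap.ext
    intro v
    rw [RootGeneratingSystem.rootAct_apply, hr, key]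
    simp [mul_comm]

theorem rootAct_self (h : S.IsReflection β r) : S.rootAct r β = -β := by
  obtain ⟨b, -, hb, -, hr⟩ := h.exists_coroot
  rw [hr, hb]; module

theorem conj (h : S.IsReflection β r) (u : S.W) :
    S.IsReflection (S.rootAct u β) (u * r * u⁻¹) := by
  obtain ⟨w, i, hβ, rfl⟩ := h
  exact ⟨u * w, i, by rw [rootAct_mul, hβ], by group⟩

end IsReflection

theorem exists_isReflection {β : Module.Dual ℝ S.V} (h : β ∈ S.realRoots) :
    ∃ r, S.IsReflection β r := by
  obtain ⟨w, i, h⟩ := h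
  exact ⟨_, w, i, h, rfl⟩

section Free
variable [Module.Free ℤ Y] [Module.Finite ℤ Y] [Finite I]

/-- `IsReflection` only provides some presentation `w rᵢ w⁻¹`, so uniqueness of the reflection has
to be proved. Here `r rᵢ` keeps every positive root positive, so its inverse has no inversions. -/
theorem IsReflection.eq_simpleReflection {i : I} {r : S.W}
    (h : S.IsReflection (S.simpleRoot i) r) : r = S.simpleReflection i := by
  have key : ∀ γ ∈ S.posRoots, S.rootAct (r * S.simpleReflection i) γ ∈ S.posRoots := by
    intro γ hγ
    rw [rootAct_mul]
    by_cases hi : γ = S.simpleRoot i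
    · subst hi
      rw [rootAct_simpleReflection_self, rootAct_neg, h.rootAct_self, neg_neg]
      exact hγ
    · have h1 := rootAct_simpleReflection_mem_posRoots hγ hi
      obtain ⟨b, -, -, -, hr⟩ := h.exists_coroot
      have h2 := rootAct_mem_realRoots r h1.1
      rw [hr] at h2 ⊢
      refine sub_smul_simpleRoot_mem_posRoots h1 (fun h3 => ?_) h2
      have h4 := congrArg (S.rootAct (S.simpleReflection i)) h3
      rw [← rootAct_mul, simpleReflection_mul_self, rootAct_one,
        rootAct_simpleReflection_self] at h4
      rw [h4, neg_mem_posRoots_iff (simpleRoot_mem_realRoots i)] at hγ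
      exact hγ (simpleRoot_mem_posRoots i)
  have h1 : (r * S.simpleReflection i)⁻¹ = 1 := by
    apply eq_one_of_invSet_eq_empty
    rw [Set.eq_empty_iff_forall_notMem]
    rintro γ ⟨h1, h2⟩
    rw [inv_inv] at h2
    exact h2 (key γ h1)
  rw [inv_eq_one, mul_eq_one_iff_eq_inv, simpleReflection_inv] at h1
  exact h1

theorem IsReflection.unique {β : Module.Dual ℝ S.V} {r r' : S.W}
    (h : S.IsReflection β r) (h' : S.IsReflection β r') : r = r' := by
  obtain ⟨w, i, hβ, rfl⟩ := h
  have h1 := h'.conj w⁻¹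
  rw [hβ, rootAct_inv_rootAct] at h1
  rw [← h1.eq_simpleReflection]
  group

end Free

/-! ### Counting the positive roots that are negative on a vector -/

variable (S) in
/-- The positive roots in `Ψ` that are negative on `ξ`. -/
def negRoots (Ψ : Set (Module.Dual ℝ S.V)) (ξ : S.V) : Set (Module.Dual ℝ S.V) :=
  {γ | γ ∈ S.posRoots ∧ γ ∈ Ψ ∧ γ ξ < 0}

variable (S) in
/-- The linear forms with an integral value at `x`. -/
def integralForms (x : S.V) : Set (Module.Dual ℝ S.V) := {γ | ∃ k : ℤ, γ x = k}

theorem IsReflection.rootAct_mem_integralForms_iff {β : Module.Dual ℝ S.V} {r : S.W}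
    (h : S.IsReflection β r) {x : S.V} (hx : β ∈ S.integralForms x) {γ : Module.Dual ℝ S.V}
    (hγ : γ ∈ S.realRoots) :
    S.rootAct r γ ∈ S.integralForms x ↔ γ ∈ S.integralForms x := by
  obtain ⟨b, hbY, -, -, hr⟩ := h.exists_coroot
  obtain ⟨n, hn⟩ := exists_int_of_mem_range_ofY hγ hbY
  obtain ⟨k, hk⟩ := hx
  have h1 : S.rootAct r γ x = γ x - n * k := by
    rw [hr]; simp [hn, hk]
  constructor
  · rintro ⟨m, hm⟩
    exact ⟨m + n * k, by push_cast; linarith⟩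
  · rintro ⟨m, hm⟩
    exact ⟨m - n * k, by push_cast; linarith⟩

theorem mem_invSet_of_apply_neg {lam : S.V} (hlam : lam ∈ S.closedChamber) {w : S.W}
    {α : Module.Dual ℝ S.V} (hα : α ∈ S.posRoots) (h : α (w • lam) < 0) : α ∈ S.invSet w := by
  refine ⟨hα, fun h1 => ?_⟩
  have := posRoots_nonneg h1 hlam
  rw [rootAct_apply, inv_inv] at this
  linarith

theorem closedChamber_of_chamber {u : S.V} (hu : u ∈ S.chamber) : u ∈ S.closedChamber :=
  fun i => (hu i).le

theorem minElt_spec {lam ξ : S.V} (hξ : ξ ∈ MulAction.orbit S.W lam) : S.minElt lam ξ • lam = ξ ∧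
    ∀ w' : S.W, w' • lam = ξ → S.length (S.minElt lam ξ) ≤ S.length w' := by
  refine Classical.epsilon_spec (p := fun w : S.W =>
    w • lam = ξ ∧ ∀ w' : S.W, w' • lam = ξ → S.length w ≤ S.length w') ?_
  obtain ⟨w, hw⟩ := hξ
  obtain ⟨v, hv, hmin⟩ := WellFounded.has_min (measure S.length).wf {w : S.W | w • lam = ξ} ⟨w, hw⟩
  exact ⟨v, hv, fun w' hw' => not_lt.1 (hmin w' hw')⟩

section Free
variable [Module.Free ℤ Y] [Module.Finite ℤ Y] [Finite I]

theorem apply_nonpos_of_mem_invSet {lam : S.V} (hlam : lam ∈ S.closedChamber) {w : S.W}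
    {α : Module.Dual ℝ S.V} (h : α ∈ S.invSet w) : α (w • lam) ≤ 0 := by
  have h1 := h.2
  rw [← neg_mem_posRoots_iff (rootAct_mem_realRoots _ h.1.1)] at h1
  have := posRoots_nonneg h1 hlam
  rw [LinearMap.neg_apply, rootAct_apply, inv_inv] at this
  linarith

theorem negRoots_finite {lam : S.V} (hlam : lam ∈ S.closedChamber)
    (Ψ : Set (Module.Dual ℝ S.V)) {ξ : S.V} (hξ : ξ ∈ MulAction.orbit S.W lam) :
    (S.negRoots Ψ ξ).Finite := by
  obtain ⟨w, rfl⟩ := hξ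
  exact (invSet_finite w).subset fun α hα => mem_invSet_of_apply_neg hlam hα.1 hα.2.2

theorem invSet_eq_negRoots {u : S.V} (hu : u ∈ S.chamber) (w : S.W) :
    S.invSet w = S.negRoots Set.univ (w • u) := by
  ext α
  refine ⟨fun h => ⟨h.1, trivial, ?_⟩, fun h =>
    mem_invSet_of_apply_neg (closedChamber_of_chamber hu) h.1 h.2.2⟩
  have h1 := h.2
  rw [← neg_mem_posRoots_iff (rootAct_mem_realRoots _ h.1.1)] at h1
  have := posRoots_pos h1 hu
  rw [LinearMap.neg_apply, rootAct_apply, inv_inv] at this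
  linarith

section Reflection

variable {β : Module.Dual ℝ S.V} {r : S.W} {ξ : S.V} {Ψ : Set (Module.Dual ℝ S.V)}

/-- If `r_β` makes `α` negative, then `α + (- r_β α)` is a positive multiple of `β`. -/
theorem IsReflection.exists_pos_smul (hr : S.IsReflection β r) (hβ : β ∈ S.posRoots)
    {α : Module.Dual ℝ S.V} (hα : α ∈ S.posRoots) (h : S.rootAct r α ∉ S.posRoots) :
    ∃ k : ℝ, 0 < k ∧ α + -S.rootAct r α = k • β := by
  obtain ⟨b, -, -, -, hb⟩ := hr.exists_coroot
  obtain ⟨u, hu⟩ := S.chamber_nonempty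
  have h1 := posRoots_pos ((neg_mem_posRoots_iff (rootAct_mem_realRoots r hα.1)).2 h) hu
  refine ⟨α b, ?_, by rw [hb]; module⟩
  rw [hb] at h1
  simp only [LinearMap.neg_apply, LinearMap.sub_apply, LinearMap.smul_apply, smul_eq_mul] at h1
  have h2 := posRoots_pos hα hu
  have h3 := posRoots_pos hβ hu
  exact pos_of_mul_pos_left (by linarith) h3.le

open Classical in
-- The map sends `α` to `r α` when that root is positive and fixes `α` otherwise. In the second case
-- `α - r α` is a positive multiple of `β`, so `α(ξ) < (r α)(ξ) < 0`. The value `β` is never taken,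
-- which makes the comparison strict when `β ∈ Ψ`.
theorem IsReflection.exists_injOn_negRoots (hr : S.IsReflection β r) (hβ : β ∈ S.posRoots)
    (hξ : β ξ < 0) (hΨ : ∀ γ ∈ S.realRoots, γ ∈ Ψ → S.rootAct r γ ∈ Ψ) :
    ∃ f : Module.Dual ℝ S.V → Module.Dual ℝ S.V,
      (∀ α ∈ S.negRoots Ψ (r • ξ), f α ∈ S.negRoots Ψ ξ \ {β}) ∧
        Set.InjOn f (S.negRoots Ψ (r • ξ)) := by
  refine ⟨fun α => if S.rootAct r α ∈ S.posRoots then S.rootAct r α else α, ?_, ?_⟩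
  · rintro α ⟨h1, h2, h3⟩
    rw [← hr.rootAct_apply] at h3
    dsimp only
    split_ifs with h
    · refine ⟨⟨h, hΨ _ h1.1 h2, h3⟩, fun h4 => ?_⟩
      have h5 := congrArg (S.rootAct r) (Set.mem_singleton_iff.1 h4)
      rw [hr.rootAct_rootAct, hr.rootAct_self] at h5
      rw [h5, neg_mem_posRoots_iff hβ.1] at h1
      exact h1 hβ
    · obtain ⟨k, hk, h4⟩ := hr.exists_pos_smul hβ h1 h
      have h5 := congrArg (fun φ : Module.Dual ℝ S.V => φ ξ) h4
      simp only [LinearMap.add_apply, LinearMap.neg_apply, LinearMap.smul_apply, smul_eq_mul] at h5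
      have h6 := mul_neg_of_pos_of_neg hk hξ
      refine ⟨⟨h1, h2, by linarith⟩, fun h7 => ?_⟩
      rw [Set.mem_singleton_iff.1 h7, hr.rootAct_self, LinearMap.neg_apply] at h3
      linarith
  · intro α hα α' hα' h
    dsimp only at h
    split_ifs at h with h1 h2 h2
    · exact rootAct_injective r h
    · exact absurd (by rw [← h, hr.rootAct_rootAct]; exact hα.1) h2
    · exact absurd (by rw [h, hr.rootAct_rootAct]; exact hα'.1) h1
    · exact h

theorem IsReflection.ncard_negRoots_le (hr : S.IsReflection β r) (hβ : β ∈ S.posRoots)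
    (hξ : β ξ < 0) (hΨ : ∀ γ ∈ S.realRoots, γ ∈ Ψ → S.rootAct r γ ∈ Ψ)
    (hfin : (S.negRoots Ψ ξ).Finite) :
    (S.negRoots Ψ (r • ξ)).ncard ≤ (S.negRoots Ψ ξ).ncard := by
  obtain ⟨f, h1, h2⟩ := hr.exists_injOn_negRoots hβ hξ hΨ
  exact Set.ncard_le_ncard_of_injOn f (fun a ha => (h1 a ha).1) h2 hfin

theorem IsReflection.ncard_negRoots_lt (hr : S.IsReflection β r) (hβ : β ∈ S.posRoots)
    (hξ : β ξ < 0) (hΨ : ∀ γ ∈ S.realRoots, γ ∈ Ψ → S.rootAct r γ ∈ Ψ) (hβΨ : β ∈ Ψ)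
    (hfin : (S.negRoots Ψ ξ).Finite) :
    (S.negRoots Ψ (r • ξ)).ncard < (S.negRoots Ψ ξ).ncard := by
  obtain ⟨f, h1, h2⟩ := hr.exists_injOn_negRoots hβ hξ hΨ
  refine (Set.ncard_le_ncard_of_injOn f h1 h2 hfin.sdiff).trans_lt ?_
  exact Set.ncard_sdiff_singleton_lt_of_mem ⟨hβ, hβΨ, hξ⟩ hfin

/-- For `u` in the open chamber the inversions of `w` are the positive roots negative on `w u`, so
the strict comparison applies to `w u`. -/
theorem IsReflection.length_mul_lt (hr : S.IsReflection β r) {w : S.W} (h : β ∈ S.invSet w) :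
    S.length (r * w) < S.length w := by
  obtain ⟨u, hu⟩ := S.chamber_nonempty
  have h0 := invSet_eq_negRoots hu w
  rw [← ncard_invSet, ← ncard_invSet, invSet_eq_negRoots hu (r * w), h0, mul_smul]
  refine hr.ncard_negRoots_lt h.1 ?_ (fun _ _ _ => trivial) trivial (h0 ▸ invSet_finite w)
  rw [h0] at h
  exact h.2.2

end Reflection

/-! ### Minimal representatives -/

section MinElt

variable {lam ξ : S.V}

/-- An inversion vanishing on `ξ` would give a reflection `r` with `r w` shorter than `w` and still
sending `λ` to `ξ`. -/
theorem invSet_eq_of_minimal (hlam : lam ∈ S.closedChamber) {w : S.W} (hw : w • lam = ξ)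
    (hmin : ∀ w' : S.W, w' • lam = ξ → S.length w ≤ S.length w') :
    S.invSet w = S.negRoots Set.univ ξ := by
  subst hw
  ext α
  refine ⟨fun h => ⟨h.1, trivial, (apply_nonpos_of_mem_invSet hlam h).lt_of_ne fun h0 => ?_⟩,
    fun h => mem_invSet_of_apply_neg hlam h.1 h.2.2⟩
  obtain ⟨r, hr⟩ := exists_isReflection h.1.1
  obtain ⟨b, -, -, hb, -⟩ := hr.exists_coroot
  have := hmin (r * w) (by rw [mul_smul, hb, h0]; simp)
  have := hr.length_mul_lt h
  omega

theorem invSet_minElt (hlam : lam ∈ S.closedChamber) (hξ : ξ ∈ MulAction.orbit S.W lam) :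
    S.invSet (S.minElt lam ξ) = S.negRoots Set.univ ξ :=
  invSet_eq_of_minimal hlam (minElt_spec hξ).1 (minElt_spec hξ).2

theorem length_minElt (hlam : lam ∈ S.closedChamber) (hξ : ξ ∈ MulAction.orbit S.W lam) :
    S.length (S.minElt lam ξ) = (S.negRoots Set.univ ξ).ncard := by
  rw [← ncard_invSet, invSet_minElt hlam hξ]

/-- Walls are exchanged for roots, and separation from `C` for negativity on `ξ`; this eliminates
`w_±(t)` from both dimensions. -/
theorem relLength_minElt (hlam : lam ∈ S.closedChamber) (hξ : ξ ∈ MulAction.orbit S.W lam)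
    (x : S.V) : S.relLength x (S.minElt lam ξ) = (S.negRoots (S.integralForms x) ξ).encard := by
  have hinj : Set.InjOn (fun α : Module.Dual ℝ S.V => LinearMap.ker α)
      (S.negRoots (S.integralForms x) ξ) := fun α hα β hβ h => eq_of_ker_eq hα.1 hβ.1 h
  rw [relLength, ← hinj.encard_image]
  congr 1
  ext M
  have key : ∀ α ∈ S.posRoots, (∀ u ∈ S.chamber, ∀ v ∈ S.chamber,
      α u * α (S.minElt lam ξ • v) < 0) ↔ α ξ < 0 := by
    intro α hα
    have h1 : α ξ < 0 ↔ α ∈ S.invSet (S.minElt lam ξ) := by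
      rw [invSet_minElt hlam hξ]
      exact ⟨fun h => ⟨hα, trivial, h⟩, fun h => h.2.2⟩
    rw [h1]
    constructor
    · intro h
      obtain ⟨u, hu⟩ := S.chamber_nonempty
      rw [invSet_eq_negRoots hu]
      exact ⟨hα, trivial, (pos_iff_neg_of_mul_neg (h u hu u hu)).1 (posRoots_pos hα hu)⟩
    · intro h u hu v hv
      rw [invSet_eq_negRoots hv] at h
      exact mul_neg_of_pos_of_neg (posRoots_pos hα hu) h.2.2
  constructor
  · rintro ⟨α, h1, h2, rfl, h3⟩
    exact ⟨α, ⟨h1, h2, (key α h1).1 h3⟩, rfl⟩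
  · rintro ⟨α, ⟨h1, h2, h3⟩, rfl⟩
    exact ⟨α, h1, h2, rfl, (key α h1).2 h3⟩

end MinElt

end Free

/-! ### Refinement of Hecke chains -/

variable (S) in
/-- A Hecke step along which the number of negative roots integral at `x` drops by one. -/
def CoverStep (x ξ ξ' : S.V) : Prop :=
  S.HeckeStep x ξ ξ' ∧
    (S.negRoots (S.integralForms x) ξ').ncard + 1 = (S.negRoots (S.integralForms x) ξ).ncard

theorem HeckeStep.mem_orbit {lam x ξ ξ' : S.V} (h : S.HeckeStep x ξ ξ')
    (hξ : ξ ∈ MulAction.orbit S.W lam) : ξ' ∈ MulAction.orbit S.W lam := by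
  obtain ⟨β, -, r, -, rfl, -⟩ := h
  exact MulAction.mem_orbit_of_mem_orbit r hξ

variable (S) in
/-- A simple root of the system of the roots integral at `x`. -/
def IsSimpleAt (x : S.V) (γ : Module.Dual ℝ S.V) (s : S.W) : Prop :=
  γ ∈ S.posRoots ∧ γ ∈ S.integralForms x ∧ S.IsReflection γ s ∧
    ∀ α ∈ S.posRoots, α ∈ S.integralForms x → α ≠ γ → S.rootAct s α ∈ S.posRoots

section Refinement

variable {lam x ξ ξ' : S.V} {γ : Module.Dual ℝ S.V} {s : S.W}

theorem IsReflection.integralForms_stable {β : Module.Dual ℝ S.V} {r : S.W}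
    (h : S.IsReflection β r) (hx : β ∈ S.integralForms x) :
    ∀ δ ∈ S.realRoots, δ ∈ S.integralForms x → S.rootAct r δ ∈ S.integralForms x :=
  fun _ hδ => (h.rootAct_mem_integralForms_iff hx hδ).2

theorem IsReflection.integralForms_compl_stable {β : Module.Dual ℝ S.V} {r : S.W}
    (h : S.IsReflection β r) (hx : β ∈ S.integralForms x) :
    ∀ δ ∈ S.realRoots, δ ∈ (S.integralForms x)ᶜ → S.rootAct r δ ∈ (S.integralForms x)ᶜ :=
  fun _ hδ h1 h2 => h1 ((h.rootAct_mem_integralForms_iff hx hδ).1 h2)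

theorem IsSimpleAt.heckeStep (hs : S.IsSimpleAt x γ s) (h : γ ξ < 0) :
    S.HeckeStep x ξ (s • ξ) :=
  ⟨γ, hs.1, s, hs.2.2.1, rfl, h, hs.2.1⟩

theorem IsSimpleAt.apply_smul (hs : S.IsSimpleAt x γ s) (ξ : S.V) : γ (s • ξ) = - γ ξ := by
  rw [← hs.2.2.1.rootAct_apply, hs.2.2.1.rootAct_self, LinearMap.neg_apply]

theorem IsSimpleAt.smul_eq_self (hs : S.IsSimpleAt x γ s) (h : γ ξ = 0) : s • ξ = ξ := by
  obtain ⟨b, -, -, hb, -⟩ := hs.2.2.1.exists_coroot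
  rw [hb, h]; simp

open Classical in
/-- The one of `η`, `s η` with more negative integral roots. -/
def raise (γ : Module.Dual ℝ S.V) (s : S.W) (η : S.V) : S.V := if γ η ≤ 0 then η else s • η

theorem raise_of_nonpos (h : γ ξ ≤ 0) : raise γ s ξ = ξ := if_pos h

theorem raise_of_pos (h : 0 < γ ξ) : raise γ s ξ = s • ξ := if_neg (not_le.2 h)

theorem CoverStep.mem_orbit_of_reflTransGen (h : Relation.ReflTransGen (S.CoverStep x) ξ ξ')
    (hξ : ξ ∈ MulAction.orbit S.W lam) : ξ' ∈ MulAction.orbit S.W lam := by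
  induction h with
  | refl => exact hξ
  | tail _ h ih => exact h.1.mem_orbit ih

end Refinement

section Free
variable [Module.Free ℤ Y] [Module.Finite ℤ Y] [Finite I]

/-- A regular vector of the chamber avoiding finitely many hyperplanes. -/
theorem exists_mem_chamber_forall_ne_zero (F : Set (Module.Dual ℝ S.V)) (hF : F.Finite)
    (h0 : ∀ f ∈ F, f ≠ 0) : ∃ u ∈ S.chamber, ∀ f ∈ F, f u ≠ 0 := by
  obtain ⟨u, hu⟩ := S.chamber_nonempty
  have := hF.to_subtype
  obtain ⟨v, hv⟩ := Module.Dual.exists_forall_ne_zero_of_forall_exists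
    (fun f : F => (f : Module.Dual ℝ S.V)) (fun f => by
      by_contra! hc
      exact h0 f f.2 (LinearMap.ext hc))
  have hcont : ∀ f : Module.Dual ℝ S.V, Filter.Tendsto (fun t : ℝ => f (u + t • v))
      (nhdsWithin 0 (Set.Ioi 0)) (nhds (f u)) := by
    intro f
    have : Filter.Tendsto (fun t : ℝ => f u + t * f v) (nhds 0) (nhds (f u + 0 * f v)) :=
      Continuous.tendsto (by fun_prop) 0
    simp only [zero_mul, add_zero] at this
    simpa using this.mono_left nhdsWithin_le_nhds
  have h1 : ∀ᶠ t : ℝ in nhdsWithin 0 (Set.Ioi 0), ∀ i, 0 < S.simpleRoot i (u + t • v) :=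
    Filter.eventually_all.2 fun i => (hcont _).eventually (lt_mem_nhds (hu i))
  have h2 : ∀ᶠ t : ℝ in nhdsWithin 0 (Set.Ioi 0), ∀ f ∈ F, f (u + t • v) ≠ 0 := by
    refine (Filter.eventually_all_finite hF).2 fun f hf => ?_
    by_cases hfu : f u = 0
    · filter_upwards [self_mem_nhdsWithin] with t ht
      simpa [hfu] using ⟨(Set.mem_Ioi.1 ht).ne', hv ⟨f, hf⟩⟩
    · exact (hcont f).eventually_ne hfu
  obtain ⟨t, ht1, ht2⟩ := (h1.and h2).exists
  exact ⟨u + t • v, ht1, ht2⟩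

/-- On the way from a generic `u` in `C` to `ξ`, the first integral wall met is simple. At the
crossing point every other positive integral root is positive, whereas `s α` negative would make `α`
and `-s α` two such roots whose sum, a multiple of `γ`, vanishes there. -/
theorem exists_isSimpleAt {x ξ : S.V} (hfin : (S.negRoots (S.integralForms x) ξ).Finite)
    (hne : (S.negRoots (S.integralForms x) ξ).Nonempty) :
    ∃ γ s, S.IsSimpleAt x γ s ∧ γ ξ < 0 := by
  set N := S.negRoots (S.integralForms x) ξ with hN
  -- Genericity makes the ratios `α(u) / α(ξ)` pairwise distinct on `N`, so the minimum below is
  -- attained once. The forms to avoid are nonzero because distinct positive roots are not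
  -- proportional.
  obtain ⟨u, hu, hgen⟩ := exists_mem_chamber_forall_ne_zero (S := S)
    ((fun p : Module.Dual ℝ S.V × Module.Dual ℝ S.V => p.2 ξ • p.1 - p.1 ξ • p.2) ''
      {p ∈ N ×ˢ N | p.1 ≠ p.2}) (((hfin.prod hfin).subset (Set.sep_subset _ _)).image _) (by
      rintro _ ⟨⟨α, α'⟩, ⟨⟨hα, hα'⟩, hne⟩, rfl⟩ h0
      dsimp only at hα hα' hne h0
      have h1 := sub_eq_zero.1 h0
      have h2 : (α ξ / α' ξ) • α' = α := by
        rw [div_eq_inv_mul, mul_smul, ← h1, inv_smul_smul₀ hα'.2.2.ne]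
      exact hne (h2 ▸ eq_of_smul_mem_posRoots hα'.1 (h2.symm ▸ hα.1)))
  obtain ⟨γ, hγ, hmin⟩ := Set.exists_min_image N
    (fun α : Module.Dual ℝ S.V => α u / -α ξ) hfin hne
  obtain ⟨s, hs⟩ := exists_isReflection hγ.1.1
  refine ⟨γ, s, ⟨hγ.1, hγ.2.1, hs, fun α hα hαx hne => ?_⟩, hγ.2.2⟩
  -- The value of `δ` at `-γ(ξ) u + γ(u) ξ`, a positive multiple of the point where the segment from
  -- `u` to `ξ` meets `Ker γ`.
  let e : Module.Dual ℝ S.V → ℝ := fun δ => δ u * (-γ ξ) + γ u * δ ξ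
  have hγξ := hγ.2.2
  have hγu := posRoots_pos hγ.1 hu
  have he : ∀ δ ∈ S.posRoots, δ ∈ S.integralForms x → 0 ≤ e δ ∧ (e δ = 0 → δ = γ) := by
    intro δ hδ hδx
    have hδu := posRoots_pos hδ hu
    rcases le_or_gt 0 (δ ξ) with h | h
    · have : 0 < e δ := add_pos_of_pos_of_nonneg (mul_pos hδu (by linarith)) (mul_nonneg hγu.le h)
      exact ⟨this.le, fun h0 => absurd h0 this.ne'⟩
    · have hδN : δ ∈ N := ⟨hδ, hδx, h⟩
      have h1 := hmin δ hδN
      rw [div_le_div_iff₀ (by linarith) (by linarith)] at h1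
      refine ⟨by dsimp only [e]; linarith, fun h0 => ?_⟩
      by_contra hne
      refine hgen _ ⟨(δ, γ), ⟨⟨hδN, hγ⟩, hne⟩, rfl⟩ ?_
      simp only [LinearMap.sub_apply, LinearMap.smul_apply, smul_eq_mul]
      dsimp only [e] at h0
      linarith
  by_contra h
  obtain ⟨k, -, hk⟩ := hs.exists_pos_smul hγ.1 hα h
  have h1 := rootAct_mem_realRoots s hα.1
  have h2 := (neg_mem_posRoots_iff h1).2 h
  obtain ⟨n, hn⟩ := (hs.rootAct_mem_integralForms_iff hγ.2.1 hα.1).2 hαx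
  have h3 := he α hα hαx
  have h4 := he _ h2 ⟨-n, by push_cast; rw [← hn]; simp⟩
  have h5 : e α + e (-S.rootAct s α) = 0 := by
    have hu' := congrArg (fun φ : Module.Dual ℝ S.V => φ u) hk
    have hξ' := congrArg (fun φ : Module.Dual ℝ S.V => φ ξ) hk
    simp only [LinearMap.add_apply, LinearMap.smul_apply, smul_eq_mul] at hu' hξ'
    dsimp only [e]
    linear_combination (-γ ξ) * hu' + γ u * hξ'
  exact hne (h3.2 (by linarith [h3.1, h4.1]))

section Refinement

variable {lam x ξ ξ' : S.V} {γ : Module.Dual ℝ S.V} {s : S.W}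

theorem HeckeStep.ncard_lt (hlam : lam ∈ S.closedChamber) (hξ : ξ ∈ MulAction.orbit S.W lam)
    (h : S.HeckeStep x ξ ξ') : (S.negRoots (S.integralForms x) ξ').ncard <
      (S.negRoots (S.integralForms x) ξ).ncard := by
  obtain ⟨β, hβ, r, hr, rfl, hneg, hx⟩ := h
  exact hr.ncard_negRoots_lt hβ hneg (hr.integralForms_stable hx) hx (negRoots_finite hlam _ hξ)

/-- A reflection integral at `x` preserves non-integrality at `x`, so the injection restricts to the
non-integral roots. This is the source of the inequality between the two dimensions. -/
theorem HeckeStep.ncard_compl_le (hlam : lam ∈ S.closedChamber)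
    (hξ : ξ ∈ MulAction.orbit S.W lam)
    (h : S.HeckeStep x ξ ξ') : (S.negRoots (S.integralForms x)ᶜ ξ').ncard ≤
      (S.negRoots (S.integralForms x)ᶜ ξ).ncard := by
  obtain ⟨β, hβ, r, hr, rfl, hneg, hx⟩ := h
  exact hr.ncard_negRoots_le hβ hneg (hr.integralForms_compl_stable hx)
    (negRoots_finite hlam _ hξ)

theorem ncard_negRoots_univ (hlam : lam ∈ S.closedChamber) (hξ : ξ ∈ MulAction.orbit S.W lam)
    (Ψ : Set (Module.Dual ℝ S.V)) : (S.negRoots Set.univ ξ).ncard =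
      (S.negRoots Ψ ξ).ncard + (S.negRoots Ψᶜ ξ).ncard := by
  rw [← Set.ncard_union_eq _ (negRoots_finite hlam _ hξ) (negRoots_finite hlam _ hξ)]
  · congr 1
    ext α
    simp only [negRoots, Set.mem_union, Set.mem_ofPred_eq, Set.mem_univ, Set.mem_compl_iff]
    tauto
  · rw [Set.disjoint_left]
    exact fun α h1 h2 => h2.2.1 h1.2.1

/-- `s` keeps positive the positive integral roots other than `γ`, so only `γ` is lost. -/
theorem IsSimpleAt.coverStep (hs : S.IsSimpleAt x γ s) (hlam : lam ∈ S.closedChamber)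
    (hξ : ξ ∈ MulAction.orbit S.W lam) (h : γ ξ < 0) : S.CoverStep x ξ (s • ξ) := by
  refine ⟨hs.heckeStep h, le_antisymm ((hs.heckeStep h).ncard_lt hlam hξ) ?_⟩
  rw [← Set.ncard_sdiff_singleton_add_one (a := γ)
    (show γ ∈ S.negRoots (S.integralForms x) ξ from ⟨hs.1, hs.2.1, h⟩) (negRoots_finite hlam _ hξ)]
  refine Nat.succ_le_succ (Set.ncard_le_ncard_of_injOn (S.rootAct s) ?_ (rootAct_injective s).injOn
    (negRoots_finite hlam _ (MulAction.mem_orbit_of_mem_orbit s hξ)))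
  rintro α ⟨⟨h1, h2, h3⟩, h4⟩
  exact ⟨hs.2.2.2 α h1 h2 h4, hs.2.2.1.integralForms_stable hs.2.1 α h1.1 h2,
    by rwa [rootAct_smul_apply]⟩

/-- Conjugating a Hecke step by a simple reflection of the integral roots. -/
theorem IsSimpleAt.heckeStep_smul (hs : S.IsSimpleAt x γ s) (h : S.HeckeStep x ξ ξ') :
    ξ' = s • ξ ∨ S.HeckeStep x (s • ξ) (s • ξ') := by
  obtain ⟨β, hβ, r, hr, rfl, hneg, hx⟩ := h
  by_cases hβγ : β = γ
  · subst hβγ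
    exact Or.inl (by rw [hr.unique hs.2.2.1])
  · refine Or.inr ⟨S.rootAct s β, hs.2.2.2 β hβ hx hβγ, s * r * s⁻¹, hr.conj s, ?_,
      by rwa [rootAct_smul_apply], hs.2.2.1.integralForms_stable hs.2.1 β hβ.1 hx⟩
    rw [mul_smul, mul_smul, inv_smul_smul]

theorem IsSimpleAt.coverStep_smul_left (hs : S.IsSimpleAt x γ s) (hlam : lam ∈ S.closedChamber)
    (hξ : ξ ∈ MulAction.orbit S.W lam) (h : 0 < γ ξ) : S.CoverStep x (s • ξ) ξ := by
  have h1 := hs.coverStep hlam (MulAction.mem_orbit_of_mem_orbit s hξ)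
    (by rw [hs.apply_smul]; linarith)
  rwa [hs.2.2.1.smul_smul] at h1

/-- Plays the part of the lifting property of the Bruhat order for the roots integral at `x`; the
cases compare the counts at `ξ`, `s ξ`, `ξ'` and `s ξ'`. -/
theorem CoverStep.raise (h : S.CoverStep x ξ ξ') (hs : S.IsSimpleAt x γ s)
    (hlam : lam ∈ S.closedChamber) (hξ : ξ ∈ MulAction.orbit S.W lam) :
    Relation.ReflTransGen (S.CoverStep x) (raise γ s ξ) (raise γ s ξ') := by
  have hξ' := h.1.mem_orbit hξ
  have hsξ : s • ξ ∈ MulAction.orbit S.W lam := MulAction.mem_orbit_of_mem_orbit s hξ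
  rcases le_or_gt (γ ξ) 0 with h1 | h1 <;> rcases le_or_gt (γ ξ') 0 with h2 | h2
  · rw [raise_of_nonpos h1, raise_of_nonpos h2]
    exact .single h
  · rw [raise_of_nonpos h1, raise_of_pos h2]
    rcases hs.heckeStep_smul h.1 with h3 | h3
    · rw [h3, hs.2.2.1.smul_smul]
    -- The count at `s ξ'` equals that at `ξ`, hence is at least that at `s ξ`; but a step from `s
    -- ξ` to `s ξ'` would lower it.
    · exfalso
      have h4 := h3.ncard_lt hlam hsξ
      have h5 := (hs.coverStep_smul_left hlam hξ' h2).2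
      have h6 := h.2
      rcases h1.lt_or_eq with h1 | h1
      · have := (hs.coverStep hlam hξ h1).2
        omega
      · rw [hs.smul_eq_self h1] at h4
        omega
  · rw [raise_of_pos h1, raise_of_nonpos h2]
    exact .head (hs.coverStep_smul_left hlam hξ h1) (.single h)
  · rw [raise_of_pos h1, raise_of_pos h2]
    rcases hs.heckeStep_smul h.1 with h3 | h3
    · have h4 := hs.apply_smul ξ
      rw [← h3] at h4
      linarith
    · refine .single ⟨h3, ?_⟩
      have h4 := (hs.coverStep_smul_left hlam hξ' h2).2
      have h5 := (hs.coverStep_smul_left hlam hξ h1).2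
      have h6 := h.2
      omega

theorem CoverStep.raise_reflTransGen (h : Relation.ReflTransGen (S.CoverStep x) ξ ξ')
    (hs : S.IsSimpleAt x γ s) (hlam : lam ∈ S.closedChamber)
    (hξ : ξ ∈ MulAction.orbit S.W lam) :
    Relation.ReflTransGen (S.CoverStep x) (RootGeneratingSystem.raise γ s ξ)
      (RootGeneratingSystem.raise γ s ξ') := by
  induction h with
  | refl => exact .refl
  | tail h1 h2 ih =>
    exact ih.trans (h2.raise hs hlam (CoverStep.mem_orbit_of_reflTransGen h1 hξ))

/-- The chain property: a Hecke step at `x` is a composition of steps along which the length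
relative to `x` drops by one. -/
theorem HeckeStep.reflTransGen_coverStep (h : S.HeckeStep x ξ ξ') (hlam : lam ∈ S.closedChamber)
    (hξ : ξ ∈ MulAction.orbit S.W lam) : Relation.ReflTransGen (S.CoverStep x) ξ ξ' := by
  induction hn : (S.negRoots (S.integralForms x) ξ).ncard using Nat.strong_induction_on
    generalizing ξ ξ' with
  | _ n ih =>
  have hfin := negRoots_finite hlam (S.integralForms x) hξ
  obtain ⟨γ, s, hs, hγ⟩ := exists_isSimpleAt hfin
    (Set.nonempty_of_ncard_ne_zero (by have := h.ncard_lt hlam hξ; omega))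
  have h0 := hs.coverStep hlam hξ hγ
  rcases hs.heckeStep_smul h with rfl | h1
  · exact .single h0
  have h2 := ih _ (by have := h0.2; omega) h1 (MulAction.mem_orbit_of_mem_orbit s hξ) rfl
  -- The chain `h2` goes from `s ξ` to `s ξ'`. If `γ(ξ') < 0`, raising both ends gives a chain from
  -- `ξ` to `ξ'`. If `s` fixes `ξ'`, prepending `ξ → s ξ` suffices; otherwise `s ξ' → ξ'` is also
  -- appended.
  rcases lt_trichotomy (γ ξ') 0 with h3 | h3 | h3
  · have h4 := CoverStep.raise_reflTransGen h2 hs hlam (MulAction.mem_orbit_of_mem_orbit s hξ)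
    rwa [raise_of_pos (by rw [hs.apply_smul]; linarith), hs.2.2.1.smul_smul,
      raise_of_pos (by rw [hs.apply_smul]; linarith), hs.2.2.1.smul_smul] at h4
  · rw [hs.smul_eq_self h3] at h2
    exact .head h0 h2
  · exact .head h0 (h2.tail (hs.coverStep_smul_left hlam (h.mem_orbit hξ) h3))

end Refinement

end Free

/-! ### Counting lemmas -/

theorem iSup_finset_sum_coe {s : Set ℝ} {g : ℝ → ℕ} (h : (s ∩ Function.support g).Finite) :
    ⨆ F : Finset s, ∑ t ∈ F, (g t : ℕ∞) = ((∑ᶠ t ∈ s, g t : ℕ) : ℕ∞) := by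
  rw [finsum_mem_eq_sum _ h]
  apply le_antisymm
  · refine iSup_le fun F => ?_
    have h1 : ∑ t ∈ F, (g t : ℕ∞) = ∑ t ∈ F.map (Function.Embedding.subtype _), (g t : ℕ∞) := by
      simp
    rw [h1, ← Nat.cast_sum, Nat.cast_le]
    refine Finset.sum_le_sum_of_ne_zero fun t ht h0 => ?_
    obtain ⟨t', -, rfl⟩ := Finset.mem_map.1 ht
    simp only [Set.Finite.mem_toFinset]
    exact ⟨t'.2, h0⟩
  · classical
    refine le_iSup_of_le (h.toFinset.subtype (· ∈ s)) ?_
    rw [Nat.cast_sum, Finset.sum_subtype_of_mem (fun t => (g t : ℕ∞))]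
    intro t ht
    exact (h.mem_toFinset.1 ht).1

theorem finsum_mem_eq_sum_card {ι : Type*} (N : Finset ι) (A : Set ℝ) (P : ℝ → ι → Prop)
    (T : ι → Finset ℝ) (hT : ∀ α ∈ N, ∀ t, t ∈ T α ↔ t ∈ A ∧ P t α) (L : ℝ → ℕ)
    (hL : ∀ t ∈ A, L t = {α | α ∈ N ∧ P t α}.ncard) :
    (A ∩ Function.support L).Finite ∧ ∑ᶠ t ∈ A, L t = ∑ α ∈ N, (T α).card := by
  classical
  have hL' : ∀ t ∈ A, L t = (N.filter (fun α => t ∈ T α)).card := by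
    intro t ht
    rw [hL t ht, ← Set.ncard_coe_finset]
    congr 1
    ext α
    simp only [Set.mem_ofPred_eq, Finset.coe_filter]
    exact and_congr_right fun hα => by rw [hT α hα]; simp [ht]
  have hsub : A ∩ Function.support L ⊆ N.biUnion T := by
    rintro t ⟨ht, h0⟩
    rw [Function.mem_support, hL' t ht, Finset.card_ne_zero] at h0
    obtain ⟨α, hα⟩ := h0
    rw [Finset.mem_filter] at hα
    exact Finset.mem_coe.2 (Finset.mem_biUnion.2 ⟨α, hα.1, hα.2⟩)
  have hA : ∀ t ∈ N.biUnion T, t ∈ A := by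
    intro t ht
    obtain ⟨α, hα, h⟩ := Finset.mem_biUnion.1 ht
    exact ((hT α hα t).1 h).1
  refine ⟨(Finset.finite_toSet _).subset hsub, ?_⟩
  rw [finsum_mem_eq_sum_of_subset (t := N.biUnion T) L hsub hA,
    Finset.sum_congr rfl fun t ht => hL' t (hA t ht)]
  have := Finset.sum_card_bipartiteAbove_eq_sum_card_bipartiteBelow (s := N.biUnion T) (t := N)
    (fun t α => t ∈ T α)
  simp only [Finset.bipartiteAbove, Finset.bipartiteBelow] at this
  rw [this]
  refine Finset.sum_congr rfl fun α hα => ?_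
  congr 1
  ext t
  simp only [Finset.mem_filter, Finset.mem_biUnion, and_iff_right_iff_imp]
  exact fun h => ⟨α, hα, h⟩

/-- The times in `(a, b]` at which a decreasing affine function is integral. -/
theorem exists_finset_Ioc_integral (a b p q : ℝ) (hab : a ≤ b) (hq : q < 0) :
    ∃ T : Finset ℝ, (∀ t, t ∈ T ↔ t ∈ Set.Ioc a b ∧ ∃ k : ℤ, p + (t - a) * q = k) ∧
      (T.card : ℤ) = ⌈p⌉ - ⌈p + (b - a) * q⌉ := by
  classical
  have hq0 := hq.ne
  -- `a + (n - p) / q` is the time at which the value is `n`. Excluding `a` and including `b` means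
  -- `p + (b - a) q ≤ n < p`, hence the ceilings; the opposite convention gives floors.
  refine ⟨(Finset.Ico ⌈p + (b - a) * q⌉ ⌈p⌉).image fun n : ℤ => a + (n - p) / q, fun t => ?_, ?_⟩
  · simp only [Finset.mem_image, Finset.mem_Ico, Set.mem_Ioc, Int.ceil_le, Int.lt_ceil]
    constructor
    · rintro ⟨n, ⟨h1, h2⟩, rfl⟩
      refine ⟨⟨?_, ?_⟩, n, ?_⟩
      · have := div_pos_of_neg_of_neg (by linarith : (n : ℝ) - p < 0) hq
        linarith
      · have : ((n : ℝ) - p) / q ≤ b - a := by rw [div_le_iff_of_neg hq]; linarith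
        linarith
      · field_simp; ring
    · rintro ⟨⟨h1, h2⟩, k, hk⟩
      refine ⟨k, ⟨?_, ?_⟩, ?_⟩
      · rw [← hk]; nlinarith
      · rw [← hk]; nlinarith
      · rw [← hk]; field_simp; ring
  · rw [Finset.card_image_of_injective, Int.card_Ico, Int.toNat_of_nonneg]
    · have : p + (b - a) * q ≤ p := by nlinarith
      have := Int.ceil_mono this
      omega
    · intro m n h
      have h1 : ((m : ℝ) - p) / q = (n - p) / q := by simpa using h
      rw [div_left_inj' hq.ne] at h1
      exact_mod_cast (sub_left_inj.1 h1)

/-- The times in `[a, b)` at which a decreasing affine function is integral. -/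
theorem exists_finset_Ico_integral (a b p q : ℝ) (hab : a ≤ b) (hq : q < 0) :
    ∃ T : Finset ℝ, (∀ t, t ∈ T ↔ t ∈ Set.Ico a b ∧ ∃ k : ℤ, p + (t - a) * q = k) ∧
      (T.card : ℤ) = ⌊p⌋ - ⌊p + (b - a) * q⌋ := by
  classical
  have hq0 := hq.ne
  refine ⟨(Finset.Ioc ⌊p + (b - a) * q⌋ ⌊p⌋).image fun n : ℤ => a + (n - p) / q, fun t => ?_, ?_⟩
  · simp only [Finset.mem_image, Finset.mem_Ioc, Set.mem_Ico, Int.le_floor, Int.floor_lt]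
    constructor
    · rintro ⟨n, ⟨h1, h2⟩, rfl⟩
      refine ⟨⟨?_, ?_⟩, n, ?_⟩
      · have := div_nonneg_of_nonpos (by linarith : (n : ℝ) - p ≤ 0) hq.le
        linarith
      · have : ((n : ℝ) - p) / q < b - a := by rw [div_lt_iff_of_neg hq]; linarith
        linarith
      · field_simp; ring
    · rintro ⟨⟨h1, h2⟩, k, hk⟩
      refine ⟨k, ⟨?_, ?_⟩, ?_⟩
      · rw [← hk]; nlinarith
      · rw [← hk]; nlinarith
      · rw [← hk]; field_simp; ring
  · rw [Finset.card_image_of_injective, Int.card_Ioc, Int.toNat_of_nonneg]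
    · have : p + (b - a) * q ≤ p := by nlinarith
      have := Int.floor_mono this
      omega
    · intro m n h
      have h1 : ((m : ℝ) - p) / q = (n - p) / q := by simpa using h
      rw [div_left_inj' hq.ne] at h1
      exact_mod_cast (sub_left_inj.1 h1)

/-! ### Tangents of piecewise linear paths -/

section Tangent

variable {π : ℝ → S.V} {t : ℝ} {ξ ξ' : S.V}

theorem HasLeftTangent.unique (h : S.HasLeftTangent π t ξ) (h' : S.HasLeftTangent π t ξ') :
    ξ = ξ' := by
  obtain ⟨ε, hε, h⟩ := h
  obtain ⟨ε', hε', h'⟩ := h'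
  have hm : 0 < min ε ε' := lt_min hε hε'
  have h1 := (h (min ε ε') ⟨hm.le, min_le_left _ _⟩).symm.trans
    (h' (min ε ε') ⟨hm.le, min_le_right _ _⟩)
  exact smul_right_injective _ hm.ne' (sub_right_injective h1)

theorem HasRightTangent.unique (h : S.HasRightTangent π t ξ) (h' : S.HasRightTangent π t ξ') :
    ξ = ξ' := by
  obtain ⟨ε, hε, h⟩ := h
  obtain ⟨ε', hε', h'⟩ := h'
  have hm : 0 < min ε ε' := lt_min hε hε'
  have h1 := (h (min ε ε') ⟨hm.le, min_le_left _ _⟩).symm.trans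
    (h' (min ε ε') ⟨hm.le, min_le_right _ _⟩)
  exact smul_right_injective _ hm.ne' (add_right_injective _ h1)

theorem HasLeftTangent.leftTangent_eq (h : S.HasLeftTangent π t ξ) : S.leftTangent π t = ξ :=
  HasLeftTangent.unique (Classical.epsilon_spec (p := S.HasLeftTangent π t) ⟨ξ, h⟩) h

theorem HasRightTangent.rightTangent_eq (h : S.HasRightTangent π t ξ) :
    S.rightTangent π t = ξ :=
  HasRightTangent.unique (Classical.epsilon_spec (p := S.HasRightTangent π t) ⟨ξ, h⟩) h

variable {a b : ℝ} {x : S.V}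

theorem hasLeftTangent_of_affine (h : ∀ t ∈ Set.Icc a b, π t = x + (t - a) • ξ)
    (ht : t ∈ Set.Ioc a b) : S.HasLeftTangent π t ξ := by
  refine ⟨t - a, sub_pos.2 ht.1, fun s hs => ?_⟩
  rw [h t ⟨ht.1.le, ht.2⟩, h (t - s) ⟨by linarith [hs.2], by linarith [hs.1, ht.2]⟩]
  module

theorem hasRightTangent_of_affine (h : ∀ t ∈ Set.Icc a b, π t = x + (t - a) • ξ)
    (ht : t ∈ Set.Ico a b) : S.HasRightTangent π t ξ := by
  refine ⟨b - t, sub_pos.2 ht.2, fun s hs => ?_⟩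
  rw [h t ⟨ht.1, ht.2.le⟩, h (t + s) ⟨by linarith [hs.1, ht.1], by linarith [hs.2]⟩]
  module

end Tangent

/-! ### Subdivisions and paths with affine segments -/

theorem IsSubdivision.monotone {r : ℕ} {a : ℕ → ℝ} (h : IsSubdivision r a) {i j : ℕ} (hij : i ≤ j)
    (hj : j ≤ r) : a i ≤ a j := by
  induction j, hij using Nat.le_induction with
  | base => exact le_rfl
  | succ j _ ih => exact (ih (by omega)).trans (h.2.2 j (by omega)).le

theorem IsSubdivision.strictMono {r : ℕ} {a : ℕ → ℝ} (h : IsSubdivision r a) {i j : ℕ}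
    (hij : i < j) (hj : j ≤ r) : a i < a j :=
  (h.2.2 i (by omega)).trans_le (h.monotone hij hj)

theorem IsSubdivision.exists_mem_Ioc {r : ℕ} {a : ℕ → ℝ} (h : IsSubdivision r a) {t : ℝ}
    (ht : t ∈ Set.Ioc (0 : ℝ) 1) : ∃ j < r, t ∈ Set.Ioc (a j) (a (j + 1)) := by
  classical
  have hex : ∃ j, t ≤ a j := ⟨r, h.2.1 ▸ ht.2⟩
  have h0 : Nat.find hex ≠ 0 := fun h0 => by
    have := Nat.find_spec hex
    rw [h0, h.1] at this
    linarith [ht.1]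
  have hr : Nat.find hex ≤ r := Nat.find_min' hex (h.2.1 ▸ ht.2)
  refine ⟨Nat.find hex - 1, by omega, not_le.1 (Nat.find_min hex (by omega)), ?_⟩
  rw [Nat.sub_add_cancel (by omega)]
  exact Nat.find_spec hex

theorem IsSubdivision.exists_mem_Ico {r : ℕ} {a : ℕ → ℝ} (h : IsSubdivision r a) {t : ℝ}
    (ht : t ∈ Set.Ico (0 : ℝ) 1) : ∃ j < r, t ∈ Set.Ico (a j) (a (j + 1)) := by
  classical
  have hex : ∃ j, t < a j := ⟨r, h.2.1 ▸ ht.2⟩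
  have h0 : Nat.find hex ≠ 0 := fun h0 => by
    have := Nat.find_spec hex
    rw [h0, h.1] at this
    linarith [ht.1]
  have hr : Nat.find hex ≤ r := Nat.find_min' hex (h.2.1 ▸ ht.2)
  refine ⟨Nat.find hex - 1, by omega, not_lt.1 (Nat.find_min hex (by omega)), ?_⟩
  rw [Nat.sub_add_cancel (by omega)]
  exact Nat.find_spec hex

variable (S) in
/-- `π` is affine with direction `ξ j` in the orbit of `lam` between `a j` and `a (j + 1)`. -/
structure IsAffineOn (lam : S.V) (π : ℝ → S.V) (r : ℕ) (a : ℕ → ℝ) (ξ : ℕ → S.V) : Prop where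
  subdivision : IsSubdivision r a
  mem_orbit : ∀ j < r, ξ j ∈ MulAction.orbit S.W lam
  affine : ∀ j < r, ∀ t ∈ Set.Icc (a j) (a (j + 1)), π t = π (a j) + (t - a j) • ξ j

theorem IsLambdaPath.exists_isAffineOn {lam : S.V} {π : ℝ → S.V} (h : S.IsLambdaPath lam π) :
    ∃ r a ξ, S.IsAffineOn lam π r a ξ := by
  obtain ⟨-, ⟨r, a, ha, hπ⟩, horb⟩ := h
  choose! ξ hξ using hπ
  refine ⟨r, a, ξ, ha, fun j hj => ?_, hξ⟩
  have h1 := ha.2.2 j hj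
  have h0 : 0 ≤ a j := ha.1 ▸ ha.monotone (Nat.zero_le j) hj.le
  have h2 : a (j + 1) ≤ 1 := ha.2.1 ▸ ha.monotone hj le_rfl
  -- At the midpoint both one-sided tangents exist and equal the direction of the segment.
  exact horb ((a j + a (j + 1)) / 2) ⟨by linarith, by linarith⟩ _
    (hasLeftTangent_of_affine (hξ j hj) ⟨by linarith, by linarith⟩)
    (hasRightTangent_of_affine (hξ j hj) ⟨by linarith, by linarith⟩)

namespace IsAffineOn

variable {lam : S.V} {π : ℝ → S.V} {r : ℕ} {a : ℕ → ℝ} {ξ : ℕ → S.V}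

theorem leftTangent_eq (h : S.IsAffineOn lam π r a ξ) {j : ℕ} (hj : j < r) {t : ℝ}
    (ht : t ∈ Set.Ioc (a j) (a (j + 1))) : S.leftTangent π t = ξ j :=
  (hasLeftTangent_of_affine (h.affine j hj) ht).leftTangent_eq

theorem rightTangent_eq (h : S.IsAffineOn lam π r a ξ) {j : ℕ} (hj : j < r) {t : ℝ}
    (ht : t ∈ Set.Ico (a j) (a (j + 1))) : S.rightTangent π t = ξ j :=
  (hasRightTangent_of_affine (h.affine j hj) ht).rightTangent_eq

theorem apply_succ (h : S.IsAffineOn lam π r a ξ) {j : ℕ} (hj : j < r) :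
    π (a (j + 1)) = π (a j) + (a (j + 1) - a j) • ξ j :=
  h.affine j hj _ ⟨(h.subdivision.2.2 j hj).le, le_rfl⟩

theorem mem_Ioo (h : S.IsAffineOn lam π r a ξ) {j : ℕ} (hj0 : 0 < j) (hj : j < r) :
    a j ∈ Set.Ioo (0 : ℝ) 1 :=
  ⟨h.subdivision.1 ▸ h.subdivision.strictMono hj0 hj.le,
    h.subdivision.2.1 ▸ h.subdivision.strictMono hj le_rfl⟩

end IsAffineOn

/-! ### The dual dimension and the codimension as sums over the segments -/

section Sums

variable {a : ℕ → ℝ} {m : ℕ} {L : ℝ → ℕ}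

theorem finsum_mem_Ioc_eq_sum (ha : ∀ j < m, a j < a (j + 1))
    (hfin : ∀ j < m, (Set.Ioc (a j) (a (j + 1)) ∩ Function.support L).Finite) :
    a 0 ≤ a m ∧ (Set.Ioc (a 0) (a m) ∩ Function.support L).Finite ∧
      ∑ᶠ t ∈ Set.Ioc (a 0) (a m), L t =
        ∑ j ∈ Finset.range m, ∑ᶠ t ∈ Set.Ioc (a j) (a (j + 1)), L t := by
  induction m with
  | zero => simp
  | succ m ih =>
    obtain ⟨h1, h2, h3⟩ := ih (fun j hj => ha j (by omega)) (fun j hj => hfin j (by omega))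
    have h4 := (ha m (by omega)).le
    have h5 := hfin m (by omega)
    rw [← Set.Ioc_union_Ioc_eq_Ioc h1 h4, Set.union_inter_distrib_right]
    refine ⟨h1.trans h4, h2.union h5, ?_⟩
    rw [finsum_mem_union' (Set.Ioc_disjoint_Ioc_of_le le_rfl) h2 h5, h3, Finset.sum_range_succ]

theorem finsum_mem_Ico_eq_sum (ha : ∀ j < m, a j < a (j + 1))
    (hfin : ∀ j < m, (Set.Ico (a j) (a (j + 1)) ∩ Function.support L).Finite) :
    a 0 ≤ a m ∧ (Set.Ico (a 0) (a m) ∩ Function.support L).Finite ∧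
      ∑ᶠ t ∈ Set.Ico (a 0) (a m), L t =
        ∑ j ∈ Finset.range m, ∑ᶠ t ∈ Set.Ico (a j) (a (j + 1)), L t := by
  induction m with
  | zero => simp
  | succ m ih =>
    obtain ⟨h1, h2, h3⟩ := ih (fun j hj => ha j (by omega)) (fun j hj => hfin j (by omega))
    have h4 := (ha m (by omega)).le
    have h5 := hfin m (by omega)
    rw [← Set.Ico_union_Ico_eq_Ico h1 h4, Set.union_inter_distrib_right]
    refine ⟨h1.trans h4, h2.union h5, ?_⟩
    rw [finsum_mem_union' (Set.Ico_disjoint_Ico_same) h2 h5, h3, Finset.sum_range_succ]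

end Sums

section Free
variable [Module.Free ℤ Y] [Module.Finite ℤ Y] [Finite I]
variable {lam : S.V} {π : ℝ → S.V} {r : ℕ} {a : ℕ → ℝ} {ξ : ℕ → S.V}

/-- The number of positive roots integral at `π(t)` and negative on `π'₋(t)`. -/
def leftCount (π : ℝ → S.V) (t : ℝ) : ℕ :=
  (S.negRoots (S.integralForms (π t)) (S.leftTangent π t)).ncard

/-- The number of positive roots integral at `π(t)` and negative on `π'₊(t)`. -/
def rightCount (π : ℝ → S.V) (t : ℝ) : ℕ :=
  (S.negRoots (S.integralForms (π t)) (S.rightTangent π t)).ncard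

/-- The pairs (time, root) are counted root by root on each segment. Intervals are closed on the
right because the left tangent at a break belongs to the segment ending there; for right tangents,
and so for codim, it is the other way round. -/
theorem IsAffineOn.ddim_eq (h : S.IsAffineOn lam π r a ξ) (hlam : lam ∈ S.closedChamber) :
    S.ddim lam π = ((∑ᶠ t ∈ Set.Ioc (0 : ℝ) 1, leftCount π t : ℕ) : ℕ∞) ∧
    ((∑ᶠ t ∈ Set.Ioc (0 : ℝ) 1, leftCount π t : ℕ) : ℤ) =
      ∑ j ∈ Finset.range r, ∑ᶠ α ∈ S.negRoots Set.univ (ξ j),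
        (⌈α (π (a j))⌉ - ⌈α (π (a (j + 1)))⌉) := by
  have hseg : ∀ j < r, (Set.Ioc (a j) (a (j + 1)) ∩ Function.support (leftCount π)).Finite ∧
      ((∑ᶠ t ∈ Set.Ioc (a j) (a (j + 1)), leftCount π t : ℕ) : ℤ) =
        ∑ᶠ α ∈ S.negRoots Set.univ (ξ j), (⌈α (π (a j))⌉ - ⌈α (π (a (j + 1)))⌉) := by
    intro j hj
    have hfin := negRoots_finite hlam Set.univ (h.mem_orbit j hj)
    have hT : ∀ α ∈ hfin.toFinset, ∃ T : Finset ℝ, (∀ t, t ∈ T ↔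
        t ∈ Set.Ioc (a j) (a (j + 1)) ∧ α ∈ S.integralForms (π t)) ∧
        (T.card : ℤ) = ⌈α (π (a j))⌉ - ⌈α (π (a (j + 1)))⌉ := by
      intro α hα
      obtain ⟨T, h1, h2⟩ := exists_finset_Ioc_integral (a j) (a (j + 1)) (α (π (a j))) (α (ξ j))
        (h.subdivision.2.2 j hj).le (hfin.mem_toFinset.1 hα).2.2
      refine ⟨T, fun t => (h1 t).trans (and_congr_right fun ht => ?_), ?_⟩
      · rw [h.affine j hj t ⟨ht.1.le, ht.2⟩]
        simp [integralForms]
      · rw [h2, h.apply_succ hj]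
        simp
    choose! T hT hcard using hT
    obtain ⟨h1, h2⟩ := finsum_mem_eq_sum_card hfin.toFinset (Set.Ioc (a j) (a (j + 1)))
      (fun t α => α ∈ S.integralForms (π t)) T hT (leftCount π) (by
        intro t ht
        rw [leftCount, h.leftTangent_eq hj ht]
        congr 1
        ext α
        simp only [negRoots, Set.mem_ofPred_eq, Set.Finite.mem_toFinset, Set.mem_univ, true_and]
        tauto)
    refine ⟨h1, ?_⟩
    rw [h2, finsum_mem_eq_finite_toFinset_sum _ hfin, Nat.cast_sum]
    exact Finset.sum_congr rfl hcard
  obtain ⟨-, h1, h2⟩ := finsum_mem_Ioc_eq_sum h.subdivision.2.2 (fun j hj => (hseg j hj).1)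
  rw [h.subdivision.1, h.subdivision.2.1] at h1 h2
  constructor
  · rw [← iSup_finset_sum_coe h1, ddim]
    refine iSup_congr fun F => Finset.sum_congr rfl fun t _ => ?_
    have ht : S.leftTangent π t ∈ MulAction.orbit S.W lam := by
      obtain ⟨j, hj, htj⟩ := h.subdivision.exists_mem_Ioc t.2
      rw [h.leftTangent_eq hj htj]
      exact h.mem_orbit j hj
    rw [relLength_minElt hlam ht, leftCount, (negRoots_finite hlam _ ht).cast_ncard_eq]
  · rw [h2, Nat.cast_sum]
    exact Finset.sum_congr rfl fun j hj => (hseg j (Finset.mem_range.1 hj)).2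

theorem IsAffineOn.codim_eq (h : S.IsAffineOn lam π r a ξ) (hlam : lam ∈ S.closedChamber) :
    S.codim lam π = ((∑ᶠ t ∈ Set.Ico (0 : ℝ) 1, rightCount π t : ℕ) : ℕ∞) ∧
    ((∑ᶠ t ∈ Set.Ico (0 : ℝ) 1, rightCount π t : ℕ) : ℤ) =
      ∑ j ∈ Finset.range r, ∑ᶠ α ∈ S.negRoots Set.univ (ξ j),
        (⌊α (π (a j))⌋ - ⌊α (π (a (j + 1)))⌋) := by
  have hseg : ∀ j < r, (Set.Ico (a j) (a (j + 1)) ∩ Function.support (rightCount π)).Finite ∧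
      ((∑ᶠ t ∈ Set.Ico (a j) (a (j + 1)), rightCount π t : ℕ) : ℤ) =
        ∑ᶠ α ∈ S.negRoots Set.univ (ξ j), (⌊α (π (a j))⌋ - ⌊α (π (a (j + 1)))⌋) := by
    intro j hj
    have hfin := negRoots_finite hlam Set.univ (h.mem_orbit j hj)
    have hT : ∀ α ∈ hfin.toFinset, ∃ T : Finset ℝ, (∀ t, t ∈ T ↔
        t ∈ Set.Ico (a j) (a (j + 1)) ∧ α ∈ S.integralForms (π t)) ∧
        (T.card : ℤ) = ⌊α (π (a j))⌋ - ⌊α (π (a (j + 1)))⌋ := by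
      intro α hα
      obtain ⟨T, h1, h2⟩ := exists_finset_Ico_integral (a j) (a (j + 1)) (α (π (a j))) (α (ξ j))
        (h.subdivision.2.2 j hj).le (hfin.mem_toFinset.1 hα).2.2
      refine ⟨T, fun t => (h1 t).trans (and_congr_right fun ht => ?_), ?_⟩
      · rw [h.affine j hj t ⟨ht.1, ht.2.le⟩]
        simp [integralForms]
      · rw [h2, h.apply_succ hj]
        simp
    choose! T hT hcard using hT
    obtain ⟨h1, h2⟩ := finsum_mem_eq_sum_card hfin.toFinset (Set.Ico (a j) (a (j + 1)))
      (fun t α => α ∈ S.integralForms (π t)) T hT (rightCount π) (by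
        intro t ht
        rw [rightCount, h.rightTangent_eq hj ht]
        congr 1
        ext α
        simp only [negRoots, Set.mem_ofPred_eq, Set.Finite.mem_toFinset, Set.mem_univ, true_and]
        tauto)
    refine ⟨h1, ?_⟩
    rw [h2, finsum_mem_eq_finite_toFinset_sum _ hfin, Nat.cast_sum]
    exact Finset.sum_congr rfl hcard
  obtain ⟨-, h1, h2⟩ := finsum_mem_Ico_eq_sum h.subdivision.2.2 (fun j hj => (hseg j hj).1)
  rw [h.subdivision.1, h.subdivision.2.1] at h1 h2
  constructor
  · rw [← iSup_finset_sum_coe h1, codim]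
    refine iSup_congr fun F => Finset.sum_congr rfl fun t _ => ?_
    have ht : S.rightTangent π t ∈ MulAction.orbit S.W lam := by
      obtain ⟨j, hj, htj⟩ := h.subdivision.exists_mem_Ico t.2
      rw [h.rightTangent_eq hj htj]
      exact h.mem_orbit j hj
    rw [relLength_minElt hlam ht, rightCount, (negRoots_finite hlam _ ht).cast_ncard_eq]
  · rw [h2, Nat.cast_sum]
    exact Finset.sum_congr rfl fun j hj => (hseg j (Finset.mem_range.1 hj)).2

end Free

/-! ### The sum of the two dimensions -/

/-- The odd `1`-periodic function `⌈z⌉ + ⌊z⌋ - 2z`. -/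
def sawtooth (z : ℝ) : ℝ := ⌈z⌉ + ⌊z⌋ - 2 * z

theorem sawtooth_neg (z : ℝ) : sawtooth (-z) = - sawtooth z := by
  simp only [sawtooth, Int.ceil_neg, Int.floor_neg]
  push_cast
  ring

theorem sawtooth_sub_int (z : ℝ) (n : ℤ) : sawtooth (z - n) = sawtooth z := by
  simp only [sawtooth, Int.ceil_sub_intCast, Int.floor_sub_intCast]
  push_cast
  ring

theorem sawtooth_int (n : ℤ) : sawtooth n = 0 := by
  simp only [sawtooth, Int.ceil_intCast, Int.floor_intCast]
  ring

theorem ceil_sub_floor (z : ℝ) [Decidable (∃ k : ℤ, z = k)] :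
    ⌈z⌉ - ⌊z⌋ = if ∃ k : ℤ, z = k then 0 else 1 := by
  split_ifs with h
  · obtain ⟨k, rfl⟩ := h
    simp
  · have h1 := Int.ceil_le_floor_add_one z
    have h2 : ⌊z⌋ < ⌈z⌉ := by
      rw [Int.lt_ceil]
      exact (Int.floor_le z).lt_of_ne fun h0 => h ⟨_, h0.symm⟩
    omega

theorem invSum_congr {c c' : Module.Dual ℝ S.V → ℝ} (h : ∀ α ∈ S.realRoots, c α = c' α) (w : S.W) :
    invSum c w = invSum c' w :=
  finsum_mem_congr rfl fun α hα => h α hα.1.1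

theorem IsReflection.sawtooth_rootAct {β : Module.Dual ℝ S.V} {r : S.W} (hr : S.IsReflection β r)
    {x : S.V} (hx : β ∈ S.integralForms x) {α : Module.Dual ℝ S.V} (hα : α ∈ S.realRoots) :
    sawtooth (S.rootAct r α x) = sawtooth (α x) := by
  obtain ⟨b, hb, -, -, h⟩ := hr.exists_coroot
  obtain ⟨k, hk⟩ := hx
  obtain ⟨n, hn⟩ := exists_int_of_mem_range_ofY hα hb
  rw [h, LinearMap.sub_apply, LinearMap.smul_apply, smul_eq_mul, hn, hk, ← Int.cast_mul,
    sawtooth_sub_int]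

theorem invSum_sawtooth_eq_zero {x : S.V} (hx : x ∈ Set.range S.ofY) (w : S.W) :
    invSum (fun α => sawtooth (α x)) w = 0 := by
  rw [invSum_congr (c' := fun _ => 0)]
  · simp [invSum]
  · intro α hα
    obtain ⟨n, hn⟩ := exists_int_of_mem_range_ofY hα hx
    rw [hn, sawtooth_int]

theorem negRoots_compl_eq_empty {x : S.V} (hx : x ∈ Set.range S.ofY) (ξ : S.V) :
    S.negRoots (S.integralForms x)ᶜ ξ = ∅ := by
  rw [Set.eq_empty_iff_forall_notMem]
  exact fun α h => h.2.1 (exists_int_of_mem_range_ofY h.1.1 hx)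

theorem IsAffineOn.sum_smul_sub {lam : S.V} {π : ℝ → S.V} {r : ℕ} {a : ℕ → ℝ} {ξ : ℕ → S.V}
    (h : S.IsAffineOn lam π r a ξ) :
    ∑ j ∈ Finset.range r, (a (j + 1) - a j) • (lam - ξ j) = lam - (π 1 - π 0) := by
  have h1 : ∀ j ∈ Finset.range r, (a (j + 1) - a j) • (lam - ξ j) =
      (a (j + 1) • lam - π (a (j + 1))) - (a j • lam - π (a j)) := by
    intro j hj
    rw [h.apply_succ (Finset.mem_range.1 hj)]
    module
  rw [Finset.sum_congr rfl h1, Finset.sum_range_sub (fun j => a j • lam - π (a j)),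
    h.subdivision.1, h.subdivision.2.1]
  module

section Free
variable [Module.Free ℤ Y] [Module.Finite ℤ Y] [Finite I]

/-- By the cocycle relation, left multiplication by `r` adds `invSum c r`; applied to `r` itself
this gives `2 invSum c r = 0`. -/
theorem IsReflection.invSum_mul_eq {β : Module.Dual ℝ S.V} {r : S.W} (hr : S.IsReflection β r)
    {c : Module.Dual ℝ S.V → ℝ} (hc : ∀ α, c (-α) = - c α)
    (hcr : ∀ α ∈ S.realRoots, c (S.rootAct r α) = c α) (w : S.W) :
    invSum c (r * w) = invSum c w := by
  have h1 : ∀ w, invSum c (r * w) = invSum c r + invSum c w := fun w => by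
    rw [invSum_mul hc, invSum_congr hcr]
  have h2 := h1 r
  rw [hr.mul_self, invSum_one] at h2
  rw [h1]
  linarith

theorem exists_invSum_sawtooth_eq {lam x ξ ξ' : S.V}
    (h : Relation.ReflTransGen (S.HeckeStep x) ξ ξ') {w : S.W} (hw : w • lam = ξ) :
    ∃ w' : S.W, w' • lam = ξ' ∧
      invSum (fun α => sawtooth (α x)) w' = invSum (fun α => sawtooth (α x)) w := by
  induction h with
  | refl => exact ⟨w, hw, rfl⟩
  | tail _ h ih =>
    obtain ⟨w', hw', h1⟩ := ih
    obtain ⟨β, -, r, hr, rfl, -, hx⟩ := h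
    refine ⟨r * w', by rw [mul_smul, hw'], ?_⟩
    rw [← h1, hr.invSum_mul_eq (fun α => by rw [LinearMap.neg_apply, sawtooth_neg])
      (fun α hα => hr.sawtooth_rootAct hx hα)]

/-- An inversion of `w` not negative on `ξ` vanishes on `ξ`, so it takes equal values at `x` and `y`
and contributes nothing. Hence `w` need not be minimal. -/
theorem finsum_mem_negRoots_sub {lam ξ : S.V} (hlam : lam ∈ S.closedChamber) {w : S.W}
    (hw : w • lam = ξ) (k : ℝ → ℝ) {x y : S.V} {t : ℝ} (hy : y = x + t • ξ) :
    ∑ᶠ α ∈ S.negRoots Set.univ ξ, (k (α x) - k (α y)) =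
      invSum (fun α => k (α x)) w - invSum (fun α => k (α y)) w := by
  refine Eq.trans ?_ (finsum_mem_sub_distrib (fun α : Module.Dual ℝ S.V => k (α x))
    (fun α => k (α y)) (invSet_finite w))
  apply finsum_mem_inter_support_eq
  subst hw
  ext α
  refine and_congr_left fun h0 => ⟨fun h => mem_invSet_of_apply_neg hlam h.1 h.2.2,
    fun h => ⟨h.1, trivial, (apply_nonpos_of_mem_invSet hlam h).lt_of_ne fun h1 => h0 ?_⟩⟩
  simp [hy, h1]

variable {lam : S.V} {π : ℝ → S.V} {r : ℕ} {a : ℕ → ℝ} {ξ : ℕ → S.V}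

/-- Telescoping: along a segment only the point moves and `w` is fixed; at a break only `w` changes,
and the Hecke chain preserves the sawtooth sum. The starting point, in `Y`, contributes nothing. -/
theorem IsAffineOn.exists_sum_sawtooth (h : S.IsAffineOn lam π r a ξ)
    (hlam : lam ∈ S.closedChamber) (h0 : π 0 ∈ Set.range S.ofY)
    (hchain : ∀ j, j + 1 < r →
      Relation.ReflTransGen (S.HeckeStep (π (a (j + 1)))) (ξ j) (ξ (j + 1)))
    {m : ℕ} (hm : m < r) : ∃ w : S.W, w • lam = ξ m ∧
      ∑ j ∈ Finset.range m, ∑ᶠ α ∈ S.negRoots Set.univ (ξ j),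
        (sawtooth (α (π (a j))) - sawtooth (α (π (a (j + 1))))) =
      - invSum (fun α => sawtooth (α (π (a m)))) w := by
  induction m with
  | zero =>
    obtain ⟨w, hw⟩ := h.mem_orbit 0 hm
    refine ⟨w, hw, ?_⟩
    rw [h.subdivision.1, invSum_sawtooth_eq_zero h0]
    simp
  | succ m ih =>
    obtain ⟨w, hw, h1⟩ := ih (by omega)
    obtain ⟨w', hw', h2⟩ := exists_invSum_sawtooth_eq (hchain m hm) hw
    refine ⟨w', hw', ?_⟩
    rw [Finset.sum_range_succ, h1, h2,
      finsum_mem_negRoots_sub hlam hw sawtooth (h.apply_succ (by omega))]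
    ring

theorem IsAffineOn.sum_sawtooth (h : S.IsAffineOn lam π r a ξ)
    (hlam : lam ∈ S.closedChamber) (h0 : π 0 ∈ Set.range S.ofY) (h1 : π 1 ∈ Set.range S.ofY)
    (hchain : ∀ j, j + 1 < r →
      Relation.ReflTransGen (S.HeckeStep (π (a (j + 1)))) (ξ j) (ξ (j + 1))) :
    ∑ j ∈ Finset.range r, ∑ᶠ α ∈ S.negRoots Set.univ (ξ j),
      (sawtooth (α (π (a j))) - sawtooth (α (π (a (j + 1))))) = 0 := by
  obtain _ | m := r
  · simp
  obtain ⟨w, hw, h2⟩ := h.exists_sum_sawtooth hlam h0 hchain (Nat.lt_succ_self m)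
  rw [Finset.sum_range_succ, h2,
    finsum_mem_negRoots_sub hlam hw sawtooth (h.apply_succ (Nat.lt_succ_self m)),
    h.subdivision.2.1, invSum_sawtooth_eq_zero h1]
  ring

/-- From `⌈z⌉ + ⌊z⌋ = sawtooth z + 2z`; the linear part is evaluated by `invSum_apply` at `x` and
`y`, using `w⁻¹ξ = λ`. -/
theorem finsum_ceil_add_finsum_floor {ρ : Module.Dual ℝ S.V}
    (hρ : ∀ i, ρ (S.simpleCoroot i) = 1) {ξ : S.V} (hlam : lam ∈ S.closedChamber)
    (hξ : ξ ∈ MulAction.orbit S.W lam) {x y : S.V} {t : ℝ} (hy : y = x + t • ξ) :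
    ((∑ᶠ α ∈ S.negRoots Set.univ ξ, (⌈α x⌉ - ⌈α y⌉) : ℤ) : ℝ) +
      ((∑ᶠ α ∈ S.negRoots Set.univ ξ, (⌊α x⌋ - ⌊α y⌋) : ℤ) : ℝ) =
    ∑ᶠ α ∈ S.negRoots Set.univ ξ, (sawtooth (α x) - sawtooth (α y)) +
      2 * (t * ρ (lam - ξ)) := by
  have hfin := negRoots_finite hlam Set.univ hξ
  have hρ' : t * ρ (lam - ξ) = ∑ α ∈ hfin.toFinset, (α x - α y) := by
    obtain ⟨w, hw⟩ := hξ
    rw [← finsum_mem_eq_finite_toFinset_sum _ hfin,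
      finsum_mem_negRoots_sub hlam hw (fun z => z) hy, invSum_apply hρ, invSum_apply hρ, hy]
    have : w⁻¹ • ξ = lam := by rw [← hw, inv_smul_smul]
    rw [smul_add, smul_comm w⁻¹ t ξ, this]
    simp only [map_add, map_sub, map_smul, smul_eq_mul]
    ring
  rw [hρ', finsum_mem_eq_finite_toFinset_sum _ hfin, finsum_mem_eq_finite_toFinset_sum _ hfin,
    finsum_mem_eq_finite_toFinset_sum _ hfin, Finset.mul_sum, ← Finset.sum_add_distrib]
  push_cast
  rw [← Finset.sum_add_distrib]
  refine Finset.sum_congr rfl fun α _ => ?_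
  rw [sawtooth, sawtooth]
  ring

theorem IsAffineOn.finsum_add_finsum (h : S.IsAffineOn lam π r a ξ) {ρ : Module.Dual ℝ S.V}
    (hρ : ∀ i, ρ (S.simpleCoroot i) = 1)
    (hlam : lam ∈ S.closedChamber) (h0 : π 0 ∈ Set.range S.ofY) (h1 : π 1 ∈ Set.range S.ofY)
    (hchain : ∀ j, j + 1 < r →
      Relation.ReflTransGen (S.HeckeStep (π (a (j + 1)))) (ξ j) (ξ (j + 1))) :
    ((∑ᶠ t ∈ Set.Ioc (0 : ℝ) 1, leftCount π t : ℕ) : ℝ) +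
      ((∑ᶠ t ∈ Set.Ico (0 : ℝ) 1, rightCount π t : ℕ) : ℝ) = 2 * ρ (lam - (π 1 - π 0)) := by
  rw [← Int.cast_natCast, (h.ddim_eq hlam).2, ← Int.cast_natCast (R := ℝ) (finsum _),
    (h.codim_eq hlam).2, Int.cast_sum, Int.cast_sum, ← Finset.sum_add_distrib,
    Finset.sum_congr rfl fun j hj => finsum_ceil_add_finsum_floor hρ hlam
      (h.mem_orbit j (Finset.mem_range.1 hj)) (h.apply_succ (Finset.mem_range.1 hj)),
    Finset.sum_add_distrib, h.sum_sawtooth hlam h0 h1 hchain, ← h.sum_smul_sub, map_sum,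
    Finset.mul_sum]
  simp

/-! ### The difference of the two dimensions -/

theorem finsum_floor_sub_finsum_ceil {ξ : S.V} (hlam : lam ∈ S.closedChamber)
    (hξ : ξ ∈ MulAction.orbit S.W lam) (x y : S.V) :
    (∑ᶠ α ∈ S.negRoots Set.univ ξ, (⌊α x⌋ - ⌊α y⌋)) -
      (∑ᶠ α ∈ S.negRoots Set.univ ξ, (⌈α x⌉ - ⌈α y⌉)) =
    ((S.negRoots (S.integralForms y)ᶜ ξ).ncard : ℤ) -
      (S.negRoots (S.integralForms x)ᶜ ξ).ncard := by
  classical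
  have hfin := negRoots_finite hlam Set.univ hξ
  have key : ∀ z : S.V, ((S.negRoots (S.integralForms z)ᶜ ξ).ncard : ℤ) =
      ∑ α ∈ hfin.toFinset, (⌈α z⌉ - ⌊α z⌋) := by
    intro z
    have h1 : S.negRoots (S.integralForms z)ᶜ ξ =
        (hfin.toFinset.filter fun α : Module.Dual ℝ S.V => ¬ ∃ k : ℤ, α z = (k : ℝ)) := by
      ext α
      simp only [negRoots, integralForms, Set.mem_ofPred_eq, Finset.coe_filter,
        Set.Finite.mem_toFinset, Set.mem_univ, true_and, Set.mem_compl_iff]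
      tauto
    rw [h1, Set.ncard_coe_finset, Finset.sum_congr rfl fun α _ => ceil_sub_floor (α z),
      Finset.card_filter, Nat.cast_sum]
    refine Finset.sum_congr rfl fun α _ => ?_
    split_ifs <;> simp
  rw [key, key, finsum_mem_eq_finite_toFinset_sum _ hfin, finsum_mem_eq_finite_toFinset_sum _ hfin,
    ← Finset.sum_sub_distrib, ← Finset.sum_sub_distrib]
  exact Finset.sum_congr rfl fun α _ => by ring

theorem IsAffineOn.finsum_sub_finsum (h : S.IsAffineOn lam π r a ξ)
    (hlam : lam ∈ S.closedChamber) (h0 : π 0 ∈ Set.range S.ofY) (h1 : π 1 ∈ Set.range S.ofY) :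
    ((∑ᶠ t ∈ Set.Ico (0 : ℝ) 1, rightCount π t : ℕ) : ℤ) -
      ((∑ᶠ t ∈ Set.Ioc (0 : ℝ) 1, leftCount π t : ℕ) : ℤ) =
    ∑ j ∈ Finset.range (r - 1), (((S.negRoots (S.integralForms (π (a (j + 1))))ᶜ (ξ j)).ncard : ℤ) -
      (S.negRoots (S.integralForms (π (a (j + 1))))ᶜ (ξ (j + 1))).ncard) := by
  rw [(h.ddim_eq hlam).2, (h.codim_eq hlam).2, ← Finset.sum_sub_distrib,
    Finset.sum_congr rfl fun j hj => finsum_floor_sub_finsum_ceil hlam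
      (h.mem_orbit j (Finset.mem_range.1 hj)) _ _]
  obtain _ | m := r
  · simp
  -- Regroup by break point instead of by segment. The two unpaired terms sit at `π 0` and `π 1`,
  -- where every root is integral.
  rw [Finset.sum_sub_distrib, Finset.sum_range_succ,
    Finset.sum_range_succ' (fun j => ((S.negRoots (S.integralForms (π (a j)))ᶜ (ξ j)).ncard : ℤ)),
    h.subdivision.1, h.subdivision.2.1, negRoots_compl_eq_empty h0, negRoots_compl_eq_empty h1,
    Nat.add_sub_cancel, Finset.sum_sub_distrib]
  simp

end Free

/-! ### Cosets and LS steps -/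

section Coset

variable {lam : S.V}

theorem cosetVec_injective : Function.Injective (S.cosetVec lam) :=
  MulAction.injective_ofQuotientStabilizer S.W lam

theorem cosetVec_smul (w : S.W) (σ : S.Coset lam) :
    S.cosetVec lam (w • σ) = w • S.cosetVec lam σ :=
  MulAction.ofQuotientStabilizer_smul S.W lam w σ

theorem cosetVec_mem_orbit (σ : S.Coset lam) : S.cosetVec lam σ ∈ MulAction.orbit S.W lam :=
  MulAction.ofQuotientStabilizer_mem_orbit S.W lam σ

theorem exists_cosetVec_eq {ξ : S.V} (hξ : ξ ∈ MulAction.orbit S.W lam) :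
    ∃ σ : S.Coset lam, S.cosetVec lam σ = ξ := by
  obtain ⟨w, rfl⟩ := hξ
  exact ⟨(w : S.Coset lam), rfl⟩

theorem add_zsmul_mem_range_ofY {u b : S.V} (hu : u ∈ Set.range S.ofY) (hb : b ∈ Set.range S.ofY)
    (n : ℤ) : u + (n : ℝ) • b ∈ Set.range S.ofY := by
  rw [Int.cast_smul_eq_zsmul]
  exact AddSubgroup.add_mem (AddMonoidHom.range S.ofY) hu (AddSubgroup.zsmul_mem _ hb n)

/-- If `x` is congruent to `t ξ` modulo the lattice, it is congruent to `t r_β(ξ)` for `β` integral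
at `x`, and integrality of `β` at `x` and at `t r_β(ξ)` agree. -/
theorem IsReflection.sub_smul_mem_range_ofY {β : Module.Dual ℝ S.V} {r : S.W}
    (hr : S.IsReflection β r) {x ξ : S.V} {t : ℝ} (h : x - t • ξ ∈ Set.range S.ofY) :
    ((∃ k : ℤ, t * β (r • ξ) = k) ↔ β ∈ S.integralForms x) ∧
      (β ∈ S.integralForms x → x - t • r • ξ ∈ Set.range S.ofY) := by
  obtain ⟨b, hb, -, hrb, -⟩ := hr.exists_coroot
  obtain ⟨n, hn⟩ := exists_int_of_mem_range_ofY hr.mem_realRoots h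
  simp only [map_sub, map_smul, smul_eq_mul] at hn
  have h1 : β (r • ξ) = - β ξ := by
    rw [← hr.rootAct_apply, hr.rootAct_self, LinearMap.neg_apply]
  refine ⟨⟨?_, ?_⟩, ?_⟩
  · rintro ⟨k, hk⟩
    refine ⟨n - k, ?_⟩
    rw [h1] at hk
    push_cast
    linarith
  · rintro ⟨k, hk⟩
    refine ⟨n - k, ?_⟩
    rw [h1]
    push_cast
    linarith
  · rintro ⟨k, hk⟩
    have h2 := add_zsmul_mem_range_ofY h hb (k - n)
    have h3 : ((k - n : ℤ) : ℝ) = t * β ξ := by push_cast; linarith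
    rw [h3] at h2
    convert h2 using 1
    rw [hrb]
    module

theorem HeckeStep.sub_smul_mem_range_ofY {x ξ ξ' : S.V} {t : ℝ}
    (h : Relation.ReflTransGen (S.HeckeStep x) ξ ξ') (hx : x - t • ξ ∈ Set.range S.ofY) :
    x - t • ξ' ∈ Set.range S.ofY := by
  induction h with
  | refl => exact hx
  | tail _ h ih =>
    obtain ⟨β, -, r, hr, rfl, -, hβ⟩ := h
    exact (hr.sub_smul_mem_range_ofY ih).2 hβ

end Coset

theorem HeckeStep.mem_orbit_of_reflTransGen {lam x ξ ξ' : S.V}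
    (h : Relation.ReflTransGen (S.HeckeStep x) ξ ξ')
    (hξ : ξ ∈ MulAction.orbit S.W lam) : ξ' ∈ MulAction.orbit S.W lam := by
  induction h with
  | refl => exact hξ
  | tail _ h ih => exact h.mem_orbit ih

section Free
variable [Module.Free ℤ Y] [Module.Finite ℤ Y] [Finite I]
variable {lam x ξ ξ' : S.V}

theorem cosetLength_eq (hlam : lam ∈ S.closedChamber) (σ : S.Coset lam) :
    S.cosetLength lam σ = (S.negRoots Set.univ (S.cosetVec lam σ)).ncard :=
  length_minElt hlam (cosetVec_mem_orbit σ)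

/-- If the number of negative roots drops by one, the minimal representatives are related by the
reflection. -/
theorem IsReflection.mul_minElt (hlam : lam ∈ S.closedChamber)
    (hξ : ξ ∈ MulAction.orbit S.W lam) {β : Module.Dual ℝ S.V} {r : S.W}
    (hr : S.IsReflection β r) (hβ : β ∈ S.posRoots) (hneg : β ξ < 0)
    (hlen : (S.negRoots Set.univ (r • ξ)).ncard + 1 = (S.negRoots Set.univ ξ).ncard) :
    S.minElt lam (r • ξ) = r * S.minElt lam ξ ∧
      S.length (r * S.minElt lam ξ) < S.length (S.minElt lam ξ) := by
  have hξ' : r • ξ ∈ MulAction.orbit S.W lam := MulAction.mem_orbit_of_mem_orbit r hξ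
  have h1 : (r * S.minElt lam ξ) • lam = r • ξ := by rw [mul_smul, (minElt_spec hξ).1]
  have h2 : S.length (r * S.minElt lam ξ) < S.length (S.minElt lam ξ) := by
    apply hr.length_mul_lt
    rw [invSet_minElt hlam hξ]
    exact ⟨hβ, trivial, hneg⟩
  refine ⟨eq_of_invSet_eq ?_, h2⟩
  rw [invSet_minElt hlam hξ', invSet_eq_of_minimal hlam h1]
  intro w' hw'
  have h3 := (minElt_spec hξ').2 w' hw'
  rw [length_minElt hlam hξ'] at h3
  rw [length_minElt hlam hξ] at h2
  omega

/-- The full length is the integral count plus the non-integral one; the first drops by one and the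
second is constant. -/
theorem CoverStep.lsStep (hlam : lam ∈ S.closedChamber) {σ σ' : S.Coset lam}
    (h : S.CoverStep x (S.cosetVec lam σ) (S.cosetVec lam σ')) {t : ℝ}
    (hx : x - t • S.cosetVec lam σ ∈ Set.range S.ofY)
    (hm : (S.negRoots (S.integralForms x)ᶜ (S.cosetVec lam σ')).ncard =
      (S.negRoots (S.integralForms x)ᶜ (S.cosetVec lam σ)).ncard) : S.LSStep lam t σ σ' := by
  obtain ⟨⟨β, hβ, r, hr, hrξ, hneg, hβx⟩, hlen⟩ := h
  obtain rfl : σ' = r • σ := cosetVec_injective (by rw [cosetVec_smul, hrξ])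
  rw [cosetVec_smul] at hlen hm
  have hξ := cosetVec_mem_orbit σ
  have hξ' := MulAction.mem_orbit_of_mem_orbit r hξ
  have hlen' : (S.negRoots Set.univ (r • S.cosetVec lam σ)).ncard + 1 =
      (S.negRoots Set.univ (S.cosetVec lam σ)).ncard := by
    rw [ncard_negRoots_univ hlam hξ (S.integralForms x),
      ncard_negRoots_univ hlam hξ' (S.integralForms x)]
    omega
  obtain ⟨h1, h2⟩ := hr.mul_minElt hlam hξ hβ hneg hlen'
  refine ⟨β, hβ, r, hr, rfl, ⟨.single ⟨β, hβ, r, hr, ?_, ?_⟩, ?_⟩, ?_, ?_⟩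
  · rw [cosetRep, cosetRep, cosetVec_smul, h1]
  · rwa [cosetRep, cosetRep, cosetVec_smul, h1]
  · intro h3
    rw [← cosetVec_smul, h3] at hlen'
    omega
  · rw [cosetVec_smul]
    exact (hr.sub_smul_mem_range_ofY hx).1.2 hβx
  · rw [cosetLength_eq hlam, cosetLength_eq hlam, cosetVec_smul]
    exact hlen'

theorem LSStep.heckeStep (hlam : lam ∈ S.closedChamber) {σ σ' : S.Coset lam} {t : ℝ}
    (h : S.LSStep lam t σ σ') (hx : x - t • S.cosetVec lam σ ∈ Set.range S.ofY) :
    S.HeckeStep x (S.cosetVec lam σ) (S.cosetVec lam σ') ∧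
      (S.negRoots (S.integralForms x)ᶜ (S.cosetVec lam σ')).ncard =
        (S.negRoots (S.integralForms x)ᶜ (S.cosetVec lam σ)).ncard := by
  obtain ⟨β, hβ, r, hr, rfl, -, hk, hlen⟩ := h
  have hξ := cosetVec_mem_orbit σ
  have hξ' := MulAction.mem_orbit_of_mem_orbit r hξ
  rw [cosetLength_eq hlam, cosetLength_eq hlam] at hlen
  rw [cosetVec_smul] at hlen hk ⊢
  have hneg : β (S.cosetVec lam σ) < 0 := by
    -- If `β` vanished on the vector, the reflection would fix it; if `β` were positive on it, the
    -- count could not drop.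
    by_contra! h0
    rcases h0.eq_or_lt with h0 | h0
    · obtain ⟨b, -, -, hb, -⟩ := hr.exists_coroot
      rw [hb, ← h0] at hlen
      simp at hlen
    · have h1 : β (r • S.cosetVec lam σ) < 0 := by
        rw [← hr.rootAct_apply, hr.rootAct_self, LinearMap.neg_apply]
        linarith
      have h2 := hr.ncard_negRoots_le (Ψ := Set.univ) hβ h1 (fun _ _ _ => trivial)
        (negRoots_finite hlam _ hξ')
      rw [hr.smul_smul] at h2
      omega
  have hstep : S.HeckeStep x (S.cosetVec lam σ) (r • S.cosetVec lam σ) :=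
    ⟨β, hβ, r, hr, rfl, hneg, (hr.sub_smul_mem_range_ofY hx).1.1 hk⟩
  refine ⟨hstep, ?_⟩
  -- The total drop is one and the integral count takes at least one, so the non-integral count,
  -- which cannot grow, is unchanged.
  have h1 := hstep.ncard_lt hlam hξ
  have h2 := hstep.ncard_compl_le hlam hξ
  rw [ncard_negRoots_univ hlam hξ (S.integralForms x),
    ncard_negRoots_univ hlam hξ' (S.integralForms x)] at hlen
  omega

theorem HeckeStep.ncard_compl_le_of_reflTransGen (hlam : lam ∈ S.closedChamber)
    (h : Relation.ReflTransGen (S.HeckeStep x) ξ ξ') (hξ : ξ ∈ MulAction.orbit S.W lam) :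
    (S.negRoots (S.integralForms x)ᶜ ξ').ncard ≤ (S.negRoots (S.integralForms x)ᶜ ξ).ncard := by
  induction h with
  | refl => exact le_rfl
  | tail h1 h2 ih =>
    exact (h2.ncard_compl_le hlam (HeckeStep.mem_orbit_of_reflTransGen h1 hξ)).trans ih

theorem HeckeStep.reflTransGen_coverStep_of_reflTransGen (hlam : lam ∈ S.closedChamber)
    (h : Relation.ReflTransGen (S.HeckeStep x) ξ ξ') (hξ : ξ ∈ MulAction.orbit S.W lam) :
    Relation.ReflTransGen (S.CoverStep x) ξ ξ' := by
  induction h with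
  | refl => exact .refl
  | tail h1 h2 ih =>
    exact ih.trans (h2.reflTransGen_coverStep hlam (HeckeStep.mem_orbit_of_reflTransGen h1 hξ))

theorem LSStep.ncard_compl_eq_of_reflTransGen (hlam : lam ∈ S.closedChamber) {σ σ' : S.Coset lam}
    {t : ℝ} (h : Relation.ReflTransGen (S.LSStep lam t) σ σ')
    (hx : x - t • S.cosetVec lam σ ∈ Set.range S.ofY) :
    (S.negRoots (S.integralForms x)ᶜ (S.cosetVec lam σ')).ncard =
        (S.negRoots (S.integralForms x)ᶜ (S.cosetVec lam σ)).ncard := by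
  have key : x - t • S.cosetVec lam σ' ∈ Set.range S.ofY ∧
      (S.negRoots (S.integralForms x)ᶜ (S.cosetVec lam σ')).ncard =
        (S.negRoots (S.integralForms x)ᶜ (S.cosetVec lam σ)).ncard := by
    induction h with
    | refl => exact ⟨hx, rfl⟩
    | tail _ h ih =>
      have h1 := h.heckeStep hlam ih.1
      exact ⟨HeckeStep.sub_smul_mem_range_ofY (.single h1.1) ih.1, h1.2.trans ih.2⟩
  exact key.2

/-- The non-integral count never increases along the chain and agrees at its ends, so it is constant
at every step. -/
theorem CoverStep.reflTransGen_lsStep (hlam : lam ∈ S.closedChamber) {σ σ' : S.Coset lam} {t : ℝ}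
    (h : Relation.ReflTransGen (S.CoverStep x) (S.cosetVec lam σ) (S.cosetVec lam σ'))
    (hx : x - t • S.cosetVec lam σ ∈ Set.range S.ofY)
    (hm : (S.negRoots (S.integralForms x)ᶜ (S.cosetVec lam σ')).ncard =
      (S.negRoots (S.integralForms x)ᶜ (S.cosetVec lam σ)).ncard) :
    Relation.ReflTransGen (S.LSStep lam t) σ σ' := by
  have hmono : ∀ {η η' : S.V}, Relation.ReflTransGen (S.CoverStep x) η η' →
      Relation.ReflTransGen (S.HeckeStep x) η η' :=
    fun h => h.lift id fun _ _ h => h.1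
  generalize hξ' : S.cosetVec lam σ' = ξ' at h hm
  induction h generalizing σ' with
  | refl => rw [cosetVec_injective hξ']
  | @tail η η' h1 h2 ih =>
    have hη := CoverStep.mem_orbit_of_reflTransGen h1 (cosetVec_mem_orbit σ)
    obtain ⟨τ, rfl⟩ := exists_cosetVec_eq hη
    have h3 := HeckeStep.ncard_compl_le_of_reflTransGen hlam (hmono h1) (cosetVec_mem_orbit σ)
    have h4 := h2.1.ncard_compl_le hlam hη
    refine (ih rfl (by omega)).tail ?_
    subst hξ'
    exact h2.lsStep hlam (HeckeStep.sub_smul_mem_range_ofY (hmono h1) hx) (by omega)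

end Free

/-! ### Hecke paths and LS paths -/

section Paths

variable {lam : S.V} {π : ℝ → S.V} {r : ℕ} {a : ℕ → ℝ} {ξ : ℕ → S.V}

theorem IsAffineOn.reflTransGen_heckeStep (h : S.IsAffineOn lam π r a ξ)
    (hπ : S.IsHeckePath lam π) (j : ℕ) (hj : j + 1 < r) :
    Relation.ReflTransGen (S.HeckeStep (π (a (j + 1)))) (ξ j) (ξ (j + 1)) := by
  have h1 := hπ.2 _ (h.mem_Ioo (Nat.succ_pos j) hj)
  rwa [h.leftTangent_eq (j := j) (by omega) ⟨h.subdivision.2.2 j (by omega), le_rfl⟩,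
    h.rightTangent_eq hj ⟨le_rfl, h.subdivision.2.2 (j + 1) hj⟩] at h1

/-- `π(t) - t ξ` is constant on a segment, starts as `π(0)`, and changes at a break by integral
multiples of coroots. It serves to translate `β(π(a)) ∈ ℤ` into `a β(ξ) ∈ ℤ`. -/
theorem IsAffineOn.sub_smul_mem_range_ofY (h : S.IsAffineOn lam π r a ξ)
    (hπ : S.IsHeckePath lam π) (h0 : π 0 ∈ Set.range S.ofY) {j : ℕ} (hj : j < r) :
    π (a (j + 1)) - a (j + 1) • ξ j ∈ Set.range S.ofY := by
  have key : π (a j) - a j • ξ j ∈ Set.range S.ofY →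
      π (a (j + 1)) - a (j + 1) • ξ j ∈ Set.range S.ofY := by
    intro h1
    convert h1 using 1
    rw [h.apply_succ hj]
    module
  apply key
  clear key
  induction j with
  | zero => rw [h.subdivision.1]; simpa using h0
  | succ j ih =>
    apply HeckeStep.sub_smul_mem_range_ofY (h.reflTransGen_heckeStep hπ j hj)
    convert ih (by omega) using 1
    rw [h.apply_succ (by omega)]
    module

/-- Two consecutive segments with the same direction can be merged. -/
theorem IsAffineOn.merge (h : S.IsAffineOn lam π r a ξ) {j : ℕ} (hj : j + 1 < r)
    (hξ : ξ j = ξ (j + 1)) :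
    S.IsAffineOn lam π (r - 1) (fun k => if k ≤ j then a k else a (k + 1))
      (fun k => if k ≤ j then ξ k else ξ (k + 1)) where
  subdivision := by
    refine ⟨by simp [h.subdivision.1], ?_, fun k hk => ?_⟩
    · dsimp only
      rw [if_neg (by omega), Nat.sub_add_cancel (by omega), h.subdivision.2.1]
    · dsimp only
      split_ifs
      · exact h.subdivision.2.2 k (by omega)
      · exact h.subdivision.strictMono (by omega) (by omega)
      · omega
      · exact h.subdivision.2.2 (k + 1) (by omega)
  mem_orbit := by
    intro k hk
    split_ifs
    · exact h.mem_orbit k (by omega)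
    · exact h.mem_orbit (k + 1) (by omega)
  affine := by
    intro k hk t ht
    rcases lt_trichotomy k j with hkj | rfl | hkj
    · simp only [hkj.le, if_true, Nat.succ_le_of_lt hkj] at ht ⊢
      exact h.affine k (by omega) t ht
    · simp only [le_refl, if_true, Nat.not_succ_le_self, if_false] at ht ⊢
      rcases le_total t (a (k + 1)) with h1 | h1
      · exact h.affine k (by omega) t ⟨ht.1, h1⟩
      · rw [h.affine (k + 1) (by omega) t ⟨h1, ht.2⟩, h.apply_succ (j := k) (by omega), hξ]
        module
    · simp only [not_le.2 hkj, if_false, show ¬ k + 1 ≤ j by omega] at ht ⊢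
      exact h.affine (k + 1) (by omega) t ht

/-- A subdivision with the fewest segments has distinct consecutive directions, as LS data require.
-/
theorem IsLambdaPath.exists_isAffineOn_ne (h : S.IsLambdaPath lam π) :
    ∃ r a ξ, S.IsAffineOn lam π r a ξ ∧ ∀ j, j + 1 < r → ξ j ≠ ξ (j + 1) := by
  classical
  have hex : ∃ r, ∃ a ξ, S.IsAffineOn lam π r a ξ := h.exists_isAffineOn
  obtain ⟨a, ξ, hr⟩ := Nat.find_spec hex
  exact ⟨_, a, ξ, hr, fun j hj hξ =>
    Nat.find_min hex (m := Nat.find hex - 1) (by omega) ⟨_, _, hr.merge hj hξ⟩⟩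

theorem IsPathWithData.isAffineOn {π₀ : S.V} {τ : ℕ → S.Coset lam}
    (h : S.IsPathWithData lam π π₀ r τ a) :
    S.IsAffineOn lam π r a (fun j => S.cosetVec lam (τ (j + 1))) where
  subdivision := h.1
  mem_orbit := fun _ _ => cosetVec_mem_orbit _
  affine := by
    intro j hj t ht
    rw [h.2.2 j hj t ht, h.2.2 j hj (a j) ⟨le_rfl, (h.1.2.2 j hj).le⟩]
    simp

theorem IsAffineOn.isPathWithData (h : S.IsAffineOn lam π r a ξ) {τ : ℕ → S.Coset lam}
    (hτ : ∀ j < r, S.cosetVec lam (τ (j + 1)) = ξ j) (hne : ∀ j, j + 1 < r → ξ j ≠ ξ (j + 1)) :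
    S.IsPathWithData lam π (π 0) r τ a := by
  refine ⟨h.subdivision, fun j hj0 hj heq => ?_, fun j hj t ht => ?_⟩
  · obtain ⟨k, rfl⟩ : ∃ k, j = k + 1 := ⟨j - 1, by omega⟩
    apply hne k hj
    rw [← hτ k (by omega), ← hτ (k + 1) hj, heq]
  · rw [h.affine j hj t ht, hτ j hj]
    congr 1
    clear ht
    induction j with
    | zero => simp [h.subdivision.1]
    | succ j ih =>
      rw [Finset.sum_range_succ, h.apply_succ (by omega), ih (by omega), hτ j (by omega), add_assoc]

variable [Module.Free ℤ Y] [Module.Finite ℤ Y] [Finite I]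

theorem IsHeckePath.ncard_compl_le (hπ : S.IsHeckePath lam π) (h : S.IsAffineOn lam π r a ξ)
    {j : ℕ} (hj : j + 1 < r) :
    (S.negRoots (S.integralForms (π (a (j + 1))))ᶜ (ξ (j + 1))).ncard ≤
      (S.negRoots (S.integralForms (π (a (j + 1))))ᶜ (ξ j)).ncard :=
  HeckeStep.ncard_compl_le_of_reflTransGen hπ.1.1 (h.reflTransGen_heckeStep hπ j hj)
    (h.mem_orbit j (by omega))

theorem IsHeckePath.finsum_leftCount_le (hπ : S.IsHeckePath lam π)
    (h0 : π 0 ∈ Set.range S.ofY) (h1 : π 1 ∈ Set.range S.ofY) :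
    ∑ᶠ t ∈ Set.Ioc (0 : ℝ) 1, leftCount π t ≤ ∑ᶠ t ∈ Set.Ico (0 : ℝ) 1, rightCount π t := by
  obtain ⟨r, a, ξ, h⟩ := hπ.1.exists_isAffineOn
  have h2 := h.finsum_sub_finsum hπ.1.1 h0 h1
  have h3 : (0 : ℤ) ≤ ((∑ᶠ t ∈ Set.Ico (0 : ℝ) 1, rightCount π t : ℕ) : ℤ) -
      ((∑ᶠ t ∈ Set.Ioc (0 : ℝ) 1, leftCount π t : ℕ) : ℤ) := by
    rw [h2]
    exact Finset.sum_nonneg fun j hj => sub_nonneg.2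
      (Nat.cast_le.2 (hπ.ncard_compl_le h (by rw [Finset.mem_range] at hj; omega)))
  omega

theorem IsHeckePath.finsum_eq_iff (hπ : S.IsHeckePath lam π) (hY : S.IsInY lam π) :
    ∑ᶠ t ∈ Set.Ioc (0 : ℝ) 1, leftCount π t = ∑ᶠ t ∈ Set.Ico (0 : ℝ) 1, rightCount π t ↔
      S.IsLSPath lam π := by
  have hlam := hπ.1.1
  constructor
  · intro heq
    obtain ⟨r, a, ξ, h, hne⟩ := hπ.1.exists_isAffineOn_ne
    have h2 := h.finsum_sub_finsum hlam hY.1 hY.2.1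
    -- A sum of non-negative drops vanishes only if each drop does.
    rw [heq, sub_self, eq_comm, Finset.sum_eq_zero_iff_of_nonneg (fun j hj => sub_nonneg.2
      (Nat.cast_le.2 (hπ.ncard_compl_le h (j := j) (by rw [Finset.mem_range] at hj; omega))))] at h2
    have hex : ∀ j < r, ∃ σ : S.Coset lam, S.cosetVec lam σ = ξ j :=
      fun j hj => exists_cosetVec_eq (h.mem_orbit j hj)
    choose! σ hσ using hex
    -- LS directions are numbered from `1` and segments from `0`, whence the shift; the value at `0`
    -- is never used.
    refine ⟨hlam, hY.2.2, π 0, hY.1, r, fun k => σ (k - 1), a, h.isPathWithData hσ hne, fun j hj0 hj => ?_⟩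
    obtain ⟨k, rfl⟩ : ∃ k, j = k + 1 := ⟨j - 1, by omega⟩
    have h3 := h2 k (by rw [Finset.mem_range]; omega)
    have hk := h.mem_orbit k (by omega)
    have h4 := HeckeStep.reflTransGen_coverStep_of_reflTransGen hlam
      (h.reflTransGen_heckeStep hπ k hj) hk
    have h5 := h.sub_smul_mem_range_ofY hπ hY.1 (j := k) (by omega)
    have e1 := hσ k (by omega)
    have e2 := hσ (k + 1) hj
    apply CoverStep.reflTransGen_lsStep (x := π (a (k + 1))) hlam
    · simpa [e1, e2] using h4
    · simpa [e1] using h5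
    · simp only [Nat.add_sub_cancel, e1, e2]
      omega
  -- The difference formula holds for any subdivision adapted to the path, in particular that of the
  -- LS data, whose steps preserve the non-integral counts.
  · rintro ⟨-, -, π₀, -, r, τ, a, hdata, hLS⟩
    have h := hdata.isAffineOn
    have h2 := h.finsum_sub_finsum hlam hY.1 hY.2.1
    rw [Finset.sum_eq_zero] at h2
    · omega
    · intro j hj
      rw [Finset.mem_range] at hj
      have h3 := h.sub_smul_mem_range_ofY hπ hY.1 (j := j) (by omega)
      rw [LSStep.ncard_compl_eq_of_reflTransGen hlam (hLS (j + 1) (by omega) (by omega)) h3,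
        sub_self]

end Paths

end

end RootGeneratingSystem

/-! ### The proposition, from the sum and the difference of the two dimensions -/

theorem proposition4p4 {I X Y : Type*} [Finite I] [AddCommGroup X] [AddCommGroup Y]
    [Module.Free ℤ X] [Module.Finite ℤ X] [Module.Free ℤ Y] [Module.Finite ℤ Y]
    (S : RootGeneratingSystem I X Y)
    (ρ : Module.Dual ℝ S.V) (hρ : ∀ i, ρ (S.simpleCoroot i) = 1)
    (lam : S.V) (π : ℝ → S.V) (hπ : S.IsHeckePath lam π) (hY : S.IsInY lam π)
    (ν : S.V) (hν : ν = π 1 - π 0) :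
    ∃ d c : ℕ, S.ddim lam π = d ∧ S.codim lam π = c ∧
      (d : ℝ) ≤ ρ (lam - ν) ∧ ρ (lam - ν) ≤ c ∧
      (d : ℝ) + c = 2 * ρ (lam - ν) ∧
      (((d : ℝ) = ρ (lam - ν) ∧ ρ (lam - ν) = c) ↔ S.IsLSPath lam π) := by
  obtain ⟨r, a, ξ, h⟩ := hπ.1.exists_isAffineOn
  have hsum := h.finsum_add_finsum hρ hπ.1.1 hY.1 hY.2.1 (h.reflTransGen_heckeStep hπ)
  have hle := hπ.finsum_leftCount_le hY.1 hY.2.1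
  have hle' := (Nat.cast_le (α := ℝ)).2 hle
  rw [← hν] at hsum
  refine ⟨_, _, (h.ddim_eq hπ.1.1).1, (h.codim_eq hπ.1.1).1, by linarith, by linarith, hsum, ?_⟩
  rw [← hπ.finsum_eq_iff hY]
  constructor
  · rintro ⟨h1, h2⟩
    exact_mod_cast h1.trans h2
  · intro heq
    rw [heq] at hsum ⊢
    constructor <;> linarith
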